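/- Notation. Let $\mathbb N=\{0,1,2,\dots\}$. For a formal power series $f(X)=\sum_{n\ge 0}t_nX^n\in\mathbb Z[[X]]$ put $S(f)=\{n\in\mathbb N: t_n\ne 0\}$. For $\mathcal A\subseteq\mathbb N$ and real $R$ put $\lambda(\mathcal A;R)=\mathrm{Card}(\mathcal A\cap[0,R))$ and, if $\mathcal A\neq\emptyset$ and $R>\min\mathcal A$, put $\theta(R;\mathcal A)=\max\{n\in\mathcal A: n<R\}$. For $k\in\mathbb N$ let $k\mathcal A$ be the Minkowski sum $\{s_1+\cdots+s_k: s_1,\dots,s_k\in\mathcal A\}$, with $0\mathcal A=\{0\}$; a sum $\sum_h k_h\mathcal A_h$ is $\{\sum_h s_h: s_h\in k_h\mathcal A_h\}$. A Pisot number is a real algebraic integer $\beta>1$ all of whose conjugates other than $\beta$ have modulus $<1$; a Salem number is a real algebraic integer $\beta>1$ all of whose conjugates other than $\beta$ have modulus $\le 1$, at least one of them having modulus $1$. Theorem. Let $A\ge 1$ and $r\ge 2$ be integers, and let $f_i(X)=\sum_{n\ge0}t_i(n)X^n$ ($i=1,\dots,r$) be power series with integer coefficients, none of which is a polynomial. Assume: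 1. There is a constant $C_7>0$ such that $0\le t_i(n)\le C_7$ for all $i=1,\dots,r$ and all $n\ge 0$. 2. For all nonnegative integers $k_1,\dots,k_r$ with $k_1\le A-1$ if $r=2$, and $k_1\le A$ if $r\ge 3$, $$R-\theta\Bigl(R;\ \sum_{h=1}^{r-2}k_hS(f_h)+(1+k_{r-1})S(f_{r-1})\Bigr)=o\left(\frac{R}{\prod_{h=1}^r\lambda(S(f_h);R)^{k_h}}\right)\qquad(R\to\infty).$$ 3. There is a real $\delta>0$ such that $\lambda(S(f_1);R)=o\bigl(R^{-\delta+1/A}\bigr)$ as $R\to\infty$; moreover, for every $i=2,\dots,r$ and every real $\varepsilon>0$, $\lambda(S(f_i);R)=o\bigl(\lambda(S(f_{i-1});R)^{\varepsilon}\bigr)$ as $R\to\infty$. 4. There are constants $C_8,C_9>0$ such that $[R,C_8R]\cap S(f_r)\ne\emptyset$ for every real $R\ge C_9$. Then for every Pisot or Salem number $\beta$ the numbers $$f_1(\beta^{-1})^{k_1}f_2(\beta^{-1})^{k_2}\cdots f_r(\beta^{-1})^{k_r}\qquad(k_1,\dots,k_r\in\mathbb N,\ k_1\le A)$$ are linearly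 independent over $\mathbb Q(\beta)$, as a family indexed by $(k_1,\dots,k_r)$ (in particular, they are pairwise distinct). -/

import Mathlib

open Filter Asymptotics
open scoped IntermediateField

noncomputable section

namespace PisotSalem

/-- Pisot number: a real algebraic integer greater than 1 all of whose other complex conjugates
have absolute value less than 1. -/
def IsPisot (β : ℝ) : Prop :=
  IsIntegral ℤ β ∧ 1 < β ∧ ∀ z ∈ (minpoly ℚ β).rootSet ℂ, z ≠ (β : ℂ) → ‖z‖ < 1

/-- Salem number: a real algebraic integer greater than 1 all of whose other complex conjugates
have absolute value at most 1, with at least one conjugate of absolute value exactly 1. -/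
def IsSalem (β : ℝ) : Prop :=
  IsIntegral ℤ β ∧ 1 < β ∧ (∀ z ∈ (minpoly ℚ β).rootSet ℂ, z ≠ (β : ℂ) → ‖z‖ ≤ 1) ∧
    ∃ z ∈ (minpoly ℚ β).rootSet ℂ, ‖z‖ = 1

/-- The support `S(f)` of a power series. -/
def supp (f : PowerSeries ℤ) : Set ℕ := {n | PowerSeries.coeff n f ≠ 0}

/-- `f` is not a polynomial. -/
def IsNonpolynomial (f : PowerSeries ℤ) : Prop := ∀ p : Polynomial ℤ, (p : PowerSeries ℤ) ≠ f

/-- The value `f(x) = ∑ t(n) xⁿ` at a real point. -/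
def value (f : PowerSeries ℤ) (x : ℝ) : ℝ := ∑' n : ℕ, ((PowerSeries.coeff n f : ℤ) : ℝ) * x ^ n

/-- The series defining `value f β⁻¹` converges when the coefficients are bounded and `β > 1`. -/
theorem summable_value {f : PowerSeries ℤ} {β C : ℝ} (hβ : 1 < β)
    (hf : ∀ n, 0 ≤ PowerSeries.coeff n f ∧ ((PowerSeries.coeff n f : ℤ) : ℝ) ≤ C) :
    Summable fun n : ℕ => ((PowerSeries.coeff n f : ℤ) : ℝ) * β⁻¹ ^ n := by
  have h0 : (0 : ℝ) ≤ β⁻¹ := by positivity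
  refine Summable.of_nonneg_of_le (fun n => ?_) (fun n => ?_)
    ((summable_geometric_of_lt_one h0 (inv_lt_one_of_one_lt₀ hβ)).mul_left C)
  · exact mul_nonneg (by exact_mod_cast (hf n).1) (pow_nonneg h0 n)
  · exact mul_le_mul_of_nonneg_right (hf n).2 (pow_nonneg h0 n)

/-- The counting function `λ(𝒜; R) = Card (𝒜 ∩ [0, R))`. -/
def count (𝒜 : Set ℕ) (R : ℝ) : ℕ := {n : ℕ | n ∈ 𝒜 ∧ (n : ℝ) < R}.ncard

/-- `θ(R; 𝒜) = max {n ∈ 𝒜 | n < R}`, meaningful for `R > min 𝒜`. -/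
def theta (R : ℝ) (𝒜 : Set ℕ) : ℕ := sSup {n : ℕ | n ∈ 𝒜 ∧ (n : ℝ) < R}

/-- For nonempty `𝒜` and `R > min 𝒜`, `theta R 𝒜` is the maximum of `{n ∈ 𝒜 | n < R}`. -/
theorem isGreatest_theta {R : ℝ} {𝒜 : Set ℕ} (h : ∃ n ∈ 𝒜, (n : ℝ) < R) :
    IsGreatest {n : ℕ | n ∈ 𝒜 ∧ (n : ℝ) < R} (theta R 𝒜) := by
  have hb : BddAbove {n : ℕ | n ∈ 𝒜 ∧ (n : ℝ) < R} :=
    ⟨⌈R⌉₊, fun n hn => by exact_mod_cast hn.2.le.trans (Nat.le_ceil R)⟩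
  obtain ⟨n, hn, hnR⟩ := h
  exact ⟨Nat.sSup_mem ⟨n, hn, hnR⟩ hb, fun m hm => le_csSup hb hm⟩

/-- The `k`-fold Minkowski sum `k𝒜 = {s₁ + ⋯ + s_k | s_j ∈ 𝒜}`, with `0𝒜 = {0}`. -/
def nfold (k : ℕ) (𝒜 : Set ℕ) : Set ℕ :=
  {n | ∃ s : Fin k → ℕ, (∀ j, s j ∈ 𝒜) ∧ n = ∑ j, s j}

/-- The Minkowski sum `∑ₕ kₕ 𝒜ₕ`. -/
def minkowski {r : ℕ} (k : Fin r → ℕ) (𝒜 : Fin r → Set ℕ) : Set ℕ :=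
  {n | ∃ s : Fin r → ℕ, (∀ h, s h ∈ nfold (k h) (𝒜 h)) ∧ n = ∑ h, s h}

/-- The multiplicities `(k₁, …, k_{r-2}, 1 + k_{r-1}, 0)`, written with indices starting at `0`
(a multiplicity `0` contributes `{0}` to a Minkowski sum, hence nothing). -/
def gapMult {r : ℕ} (k : Fin r → ℕ) : Fin r → ℕ := fun h =>
  if h.val + 2 < r then k h else if h.val + 2 = r then 1 + k h else 0

end PisotSalem

end

namespace PisotSalem

/-! Suppose a nontrivial relation holds. Multiplying it by a monomial and an integer makes its
coefficients algebraic integers of `ℚ⟮β⟯`. Its lexicographically largest exponent `g` then has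
positive last two entries and a positive coefficient. Let `G m` be the coefficient of `X ^ m` in the
combined series, `T` the support of the leading monomial, and `B` the union of the supports of the
lexicographically smaller monomials in a finite box. Off `B` only the leading monomial contributes,
so `G ≥ 0` there, and `G` is bounded below on `T \ B`.

Put `X n = ∑ G (n + l) β⁻ˡ`. As the whole series vanishes, `X n` is minus `β ^ n` times a partial
sum. This is an algebraic integer whose other conjugates grow polynomially, because the other
conjugates of `β` have modulus at most 1. Taking norms, `X n` is zero or at least a negative power
of `n` (`exists_partial_sum_lower_bound`). Two opposite consequences follow
(`sparse_series_contradiction`).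

Nonzero `X n` forces a point of `B ∪ T` within a logarithmic distance after `n`. Since `B ∪ T` has
`O(N ^ (1 - η))` points below `N`, `X` vanishes at almost all integers.

On the other hand, let `(i, j)` be a gap of `B`. If `i` comes from an exponent differing from `g`
only in the last entry, then `i + s` lies in `B ∪ T` for each `s` in the last support. In a long
gap, hypothesis 4 supplies such a point of `T` at a positive proportion of the gap, and positivity
of `G` makes `X` nonzero on the stretch leading up to it. The remaining left ends form the set `E`:
they are `O(w N)` in number, and hypothesis 2 makes their gaps `o(N / w N)`. So gaps of `B` cannot
cover `[N, 2N)` (`counting_contradiction`). -/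

open Classical in
theorem count_natCast (𝒜 : Set ℕ) (N : ℕ) :
    count 𝒜 (N : ℝ) = ((Finset.range N).filter (· ∈ 𝒜)).card := by
  rw [count, ← Set.ncard_coe_finset]
  congr 1
  ext n
  simp [and_comm]

theorem count_mono (𝒜 : Set ℕ) {x y : ℝ} (h : x ≤ y) : count 𝒜 x ≤ count 𝒜 y := by
  refine Set.ncard_le_ncard (fun n hn => ⟨hn.1, hn.2.trans_le h⟩) ?_
  exact (Set.finite_Iio ⌈y⌉₊).subset fun n hn => Nat.lt_ceil.2 hn.2

/-! ### Counting gaps in a dyadic block -/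

/-- A function of at most linear growth fails to quadruple at arbitrarily large dyadic scales. -/
theorem exists_doubling {w : ℕ → ℕ} {C : ℝ} (hw : ∀ᶠ N : ℕ in atTop, (w N : ℝ) ≤ C * N)
    (hpos : ∀ᶠ N : ℕ in atTop, 1 ≤ w N) : ∃ᶠ N : ℕ in atTop, w (2 * N) ≤ 4 * w N := by
  intro hcon
  obtain ⟨N₀, hN₀⟩ := eventually_atTop.1 ((hw.and hpos).and (hcon.and (eventually_ge_atTop 1)))
  have hge : ∀ t : ℕ, N₀ ≤ 2 ^ t * N₀ := fun t => Nat.le_mul_of_pos_left _ (by positivity)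
  -- Repeated quadrupling gives growth `4 ^ t` at `2 ^ t * N₀`, against the linear bound `C * 2 ^ t
  -- * N₀`.
  have hgrow : ∀ t : ℕ, 4 ^ t ≤ w (2 ^ t * N₀) := by
    intro t
    induction t with
    | zero => simpa using (hN₀ N₀ le_rfl).1.2
    | succ t ih =>
      have := (hN₀ _ (hge t)).2.1
      rw [pow_succ, pow_succ, mul_comm (2 ^ t) 2, mul_assoc]
      omega
  have hbd : ∀ t : ℕ, (2 : ℝ) ^ t ≤ C * N₀ := by
    intro t
    have h1 : ((4 ^ t : ℕ) : ℝ) ≤ w (2 ^ t * N₀) := by exact_mod_cast hgrow t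
    have h2 := h1.trans (hN₀ _ (hge t)).1.1
    push_cast at h2
    have h4 : (4 : ℝ) ^ t = 2 ^ t * 2 ^ t := by rw [← mul_pow]; norm_num
    have hp : (0 : ℝ) < 2 ^ t := by positivity
    rw [h4] at h2
    refine le_of_mul_le_mul_left (a := (2 : ℝ) ^ t) ?_ hp
    linarith
  obtain ⟨t, ht⟩ := pow_unbounded_of_one_lt (C * N₀) (one_lt_two (α := ℝ))
  exact absurd (hbd t) (not_le.2 ht)

open Classical in
/-- If every point of `Z` below `M` is followed within distance `ℓ` by a point of `𝒜`, then `Z` has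
at most `ℓ` times as many points as `𝒜`. -/
theorem card_le_mul_count {𝒜 : Set ℕ} {Z : ℕ → Prop} {M ℓ : ℕ}
    (h : ∀ n < M, Z n → ∃ m ∈ 𝒜, n ≤ m ∧ m < n + ℓ) :
    ((Finset.range M).filter Z).card ≤ count 𝒜 ((M + ℓ : ℕ) : ℝ) * ℓ := by
  rw [count_natCast]
  have hsub : (Finset.range M).filter Z ⊆
      -- For `m < ℓ` the truncated difference `m - ℓ` is 0, and the half-open interval misses the
      -- point 0; it is added by hand.
      ((Finset.range (M + ℓ)).filter (· ∈ 𝒜)).biUnion fun m => Finset.Ioc (m - ℓ) m ∪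
        (if m < ℓ then {0} else ∅) := by
    intro n hn
    simp only [Finset.mem_filter, Finset.mem_range] at hn
    obtain ⟨m, hm, h1, h2⟩ := h n hn.1 hn.2
    simp only [Finset.mem_biUnion, Finset.mem_filter, Finset.mem_range, Finset.mem_union,
      Finset.mem_Ioc]
    refine ⟨m, ⟨by omega, hm⟩, ?_⟩
    by_cases hmℓ : m < ℓ
    · rcases Nat.eq_zero_or_pos n with rfl | hn0
      · right; simp [hmℓ]
      · left; omega
    · left; omega
  refine (Finset.card_le_card hsub).trans (Finset.card_biUnion_le_card_mul _ _ _ fun m _ => ?_)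
  refine (Finset.card_union_le _ _).trans ?_
  rw [Nat.card_Ioc]
  split_ifs with hm
  · simp; omega
  · simp; omega

open Classical in
/-- A set `Z` of integers cannot both be covered by short intervals ending in the sparse set `B ∪ T`
and contain a positive proportion of each long gap of `B` whose left end is not in `E`. -/
theorem counting_contradiction {B T E S : Set ℕ} {Z : ℕ → Prop} {ℓ w : ℕ → ℕ} {η C C₈ C₉ : ℝ}
    (hη : 0 < η) (hη' : η ≤ 1) (hC : 0 < C) (hC₈ : 0 < C₈) (h0 : 0 ∈ B)
    (hcount : ∀ᶠ N : ℕ in atTop, (count (B ∪ T) N : ℝ) ≤ C * (N : ℝ) ^ (1 - η))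
    (hE : ∀ᶠ N : ℕ in atTop, (count E N : ℝ) ≤ C * w N)
    (hw : ∀ᶠ N : ℕ in atTop, (w N : ℝ) ≤ C * (N : ℝ) ^ (1 - η))
    (hmono : Monotone w) (hpos : ∀ᶠ N : ℕ in atTop, 1 ≤ w N)
    (hgap : ∀ ε : ℝ, 0 < ε → ∀ᶠ n : ℕ in atTop,
      ∃ b ∈ B, b < n ∧ (n : ℝ) - b ≤ ε * (n / w n))
    (hstep : ∀ i ∈ B, i ∉ E → ∀ s ∈ S, i + s ∈ B ∪ T)
    (hS : ∀ x : ℝ, C₉ ≤ x → ∃ s ∈ S, x ≤ (s : ℝ) ∧ (s : ℝ) ≤ C₈ * x)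
    (hℓ : ∀ ε : ℝ, 0 < ε → ∀ᶠ N : ℕ in atTop, (ℓ N : ℝ) ≤ ε * (N : ℝ) ^ η)
    (hZ : ∀ᶠ N : ℕ in atTop, ∀ n < 4 * N, Z n → ∃ m ∈ B ∪ T, n ≤ m ∧ m < n + ℓ N)
    (hZ' : ∀ᶠ N : ℕ in atTop, ∀ i p j : ℕ, j ≤ 4 * N → (∀ b ∈ B, i < b → j ≤ b) → p ∈ T →
      i < p → p + ℓ N ≤ j → ∀ n, i < n → n ≤ p → Z n) : False := by
  have hBinf : ∀ i : ℕ, ∃ b ∈ B, i < b := by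
    intro i
    obtain ⟨n, ⟨⟨b, hb, -, hle⟩, hw1⟩, hn⟩ :=
      (((hgap (1 / 2) (by norm_num)).and hpos).and (eventually_gt_atTop (2 * i))).exists
    refine ⟨b, hb, ?_⟩
    have h1 : (n : ℝ) / w n ≤ n := div_le_self (by positivity) (by exact_mod_cast hw1)
    have h2 : (2 * i : ℝ) < n := by exact_mod_cast hn
    have h3 : (i : ℝ) < b := by linarith
    exact_mod_cast h3
  choose! j hj using fun i => (⟨Nat.find (hBinf i), (Nat.find_spec (hBinf i)).1,
    (Nat.find_spec (hBinf i)).2, fun b hb hib => Nat.find_min' (hBinf i) ⟨hb, hib⟩⟩ :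
      ∃ j ∈ B, i < j ∧ ∀ b ∈ B, i < b → j ≤ b)
  -- The last point of `B` before `n`; `0 ∈ B` guarantees one for `n ≥ 1`, and the value at 0 is a
  -- default.
  set pred : ℕ → ℕ := fun n => Nat.findGreatest (· ∈ B) (n - 1) with hpred
  have hpredB : ∀ n, pred n ∈ B := fun n => Nat.findGreatest_spec (P := (· ∈ B)) (Nat.zero_le _) h0
  have hpredlt : ∀ n, 1 ≤ n → pred n < n := fun n hn => by
    have := Nat.findGreatest_le (P := (· ∈ B)) (n - 1)
    simp only [hpred]; omega
  have hpredmax : ∀ n b, b ∈ B → b < n → b ≤ pred n := fun n b hb hbn =>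
    Nat.le_findGreatest (by omega) hb
  -- Gaps longer than `c` have `L / (2 * C₈) ≥ C₉`, so that `hS` applies at that point.
  set c : ℝ := 2 + 2 * C₈ * |C₉| with hc
  have hc0 : 0 < c := by positivity
  have hexp : Tendsto (fun N : ℕ => (N : ℝ) ^ η) atTop atTop :=
    (tendsto_rpow_atTop hη).comp tendsto_natCast_atTop_atTop
  have hmul : ∀ k : ℕ, 0 < k → Tendsto (fun N : ℕ => k * N) atTop atTop := fun k hk =>
    tendsto_id.const_mul_atTop' hk
  -- Left ends in `E` are counted below `2 * N`, but their gaps are measured against `w N`; doubling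
  -- compares the two scales.
  have hdouble := exists_doubling (w := w) (C := C) (by
    filter_upwards [hw, eventually_ge_atTop 1] with N h hN
    refine h.trans (mul_le_mul_of_nonneg_left ?_ hC.le)
    calc (N : ℝ) ^ (1 - η) ≤ (N : ℝ) ^ (1 : ℝ) :=
          Real.rpow_le_rpow_of_exponent_le (by exact_mod_cast hN) (by linarith)
      _ = N := Real.rpow_one _) hpos
  -- The value 1/2 keeps right ends below `4 * N`. With `1 / (64 * C)`, at most `4 * C * w N` gaps
  -- from `E`, each of length at most `4 * N / (64 * C * w N)`, total at most `N / 4`.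
  obtain ⟨N₁, hN₁⟩ := eventually_atTop.1 ((hgap (1 / 2) (by norm_num)).and
    ((hgap (1 / (64 * C)) (by positivity)).and hpos))
  -- The bounds on `ℓ N` serve, in order, to give `ℓ N ≤ N`, to make the short gaps total at most `N
  -- / 4`, and to leave at most `N / (8 * C₈)` points in `Z`.
  obtain ⟨N, hNd, hNE, hN2, hN5, hNℓ1, hNℓ2, hNℓ3, hNc, hNZ, hNZ', hNge⟩ :=
    (hdouble.and_eventually (((hmul 2 (by norm_num)).eventually hE).and
      (((hmul 2 (by norm_num)).eventually hcount).and
      (((hmul 5 (by norm_num)).eventually hcount).and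
      ((hℓ 1 one_pos).and ((hℓ (1 / (32 * C)) (by positivity)).and
      ((hℓ (1 / (40 * C * C₈)) (by positivity)).and
      ((hexp.eventually_ge_atTop (16 * C * c)).and (hZ.and (hZ'.and
      (eventually_ge_atTop (N₁ + 1)))))))))))).exists
  have hN1 : (1 : ℝ) ≤ N := by exact_mod_cast (by omega : 1 ≤ N)
  have hNpos : (0 : ℝ) < N := by linarith
  have hNη : (N : ℝ) ^ (1 - η) * (N : ℝ) ^ η = N := by
    rw [← Real.rpow_add hNpos]; simp
  have hscale : ∀ k : ℕ, 1 ≤ k → ((k * N : ℕ) : ℝ) ^ (1 - η) ≤ k * (N : ℝ) ^ (1 - η) := by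
    intro k hk
    push_cast
    rw [Real.mul_rpow (by positivity) (by positivity)]
    gcongr
    calc (k : ℝ) ^ (1 - η) ≤ (k : ℝ) ^ (1 : ℝ) :=
          Real.rpow_le_rpow_of_exponent_le (by exact_mod_cast hk) (by linarith)
      _ = k := Real.rpow_one _
  have hwN : (0 : ℝ) < w N := by exact_mod_cast (hN₁ N (by omega)).2.2
  have hℓN : ℓ N ≤ N := by
    have : (N : ℝ) ^ η ≤ (N : ℝ) ^ (1 : ℝ) := Real.rpow_le_rpow_of_exponent_le hN1 hη'
    rw [Real.rpow_one] at this
    have h2 : (ℓ N : ℝ) ≤ N := by linarith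
    exact_mod_cast h2
  set I := (Finset.Ico N (2 * N)).image pred with hI
  set z : ℕ → ℕ := fun i => ((((Finset.range (4 * N)).filter Z)).filter (pred · = i)).card with hz
  have hIprop : ∀ i ∈ I, i ∈ B ∧ i < 2 * N ∧ N ≤ j i ∧ j i ≤ 4 * N := by
    intro i hi
    obtain ⟨n, hn, rfl⟩ := Finset.mem_image.1 hi
    rw [Finset.mem_Ico] at hn
    have hlt := hpredlt n (by omega)
    obtain ⟨hjB, hij, hjmin⟩ := hj (pred n)
    have hnj : n ≤ j (pred n) := by
      by_contra hcon
      exact absurd (hpredmax n _ hjB (by omega)) (by omega)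
    refine ⟨hpredB n, by omega, by omega, ?_⟩
    obtain ⟨⟨b, hb, hbj, hle⟩, -, hw1⟩ := hN₁ (j (pred n)) (by omega)
    have hbi : b ≤ pred n := by
      by_contra hcon
      exact absurd (hjmin b hb (by omega)) (by omega)
    have h1 : (j (pred n) : ℝ) / w (j (pred n)) ≤ j (pred n) :=
      div_le_self (by positivity) (by exact_mod_cast hw1)
    have h2 : (j (pred n) : ℝ) ≤ 2 * b := by linarith
    have h3 : j (pred n) ≤ 2 * b := by exact_mod_cast h2
    omega
  -- Each summand pays for one kind of gap: left end in `E`, short, or long with a positive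
  -- proportion of its points in `Z`.
  have hlen : ∀ i ∈ I, ((j i : ℝ) - i) ≤ (if i ∈ E then N / (16 * C * w N) else 0) +
      (2 * ℓ N + c) + 2 * C₈ * z i := by
    intro i hi
    obtain ⟨hiB, hi2, hjN, hj4⟩ := hIprop i hi
    obtain ⟨hjB, hij, hjmin⟩ := hj i
    have hj4' : (j i : ℝ) ≤ 4 * N := by exact_mod_cast hj4
    by_cases hiE : i ∈ E
    · rw [if_pos hiE]
      obtain ⟨-, ⟨b, hb, hbj, hle⟩, hw1⟩ := hN₁ (j i) (by omega)
      have hbi : b ≤ i := by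
        by_contra hcon
        exact absurd (hjmin b hb (by omega)) (by omega)
      have hbi' : (b : ℝ) ≤ i := by exact_mod_cast hbi
      have hww : (w N : ℝ) ≤ w (j i) := by exact_mod_cast hmono hjN
      have h1 : (j i : ℝ) / w (j i) ≤ 4 * N / w N := by gcongr
      have h2 : 1 / (64 * C) * ((j i : ℝ) / w (j i)) ≤ N / (16 * C * w N) := by
        calc _ ≤ 1 / (64 * C) * (4 * N / w N) := by gcongr
          _ = _ := by field_simp; norm_num
      have h3 : 0 ≤ 2 * C₈ * z i := by positivity
      have h4 : (0 : ℝ) ≤ 2 * ℓ N + c := by positivity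
      linarith
    · rw [if_neg hiE]
      rcases le_total ((j i : ℝ) - i) (2 * ℓ N + c) with hshort | hlong
      · have h3 : 0 ≤ 2 * C₈ * z i := by positivity
        linarith
      · set L : ℝ := (j i : ℝ) - i with hL
        have hℓ0 : (0 : ℝ) ≤ ℓ N := by positivity
        have hLpos : 0 < L := by linarith
        -- Aiming at `L / (2 * C₈)` gives `s ≤ L / 2`, which leaves room `ℓ N` before the right end,
        -- while `L ≤ 2 * C₈ * s`.
        have hx : C₉ ≤ L / (2 * C₈) := by
          rw [le_div_iff₀ (by positivity)]
          have := le_abs_self C₉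
          nlinarith
        obtain ⟨s, hs, hs1, hs2⟩ := hS _ hx
        have hs2' : (s : ℝ) ≤ L / 2 := by
          refine hs2.trans_eq ?_
          field_simp
        have hs0 : 0 < s := by
          have : (0 : ℝ) < s := lt_of_lt_of_le (by positivity) hs1
          exact_mod_cast this
        have hsj : i + s + ℓ N ≤ j i := by
          have : ((i + s + ℓ N : ℕ) : ℝ) ≤ j i := by push_cast; linarith
          exact_mod_cast this
        have hsj' : i + s < j i := by
          have : ((i + s : ℕ) : ℝ) < j i := by push_cast; linarith
          exact_mod_cast this
        have hsT : i + s ∈ T := by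
          rcases hstep i hiB hiE s hs with h | h
          · exact absurd (hjmin _ h (by omega)) (by omega)
          · exact h
        have hsz : s ≤ z i := by
          have hsub : Finset.Ioc i (i + s) ⊆
              (((Finset.range (4 * N)).filter Z)).filter (pred · = i) := by
            intro n hn
            rw [Finset.mem_Ioc] at hn
            simp only [Finset.mem_filter, Finset.mem_range]
            refine ⟨⟨by omega, hNZ' i (i + s) (j i) hj4 hjmin hsT (by omega) hsj n hn.1 hn.2⟩,
              le_antisymm ?_ (hpredmax n i hiB hn.1)⟩
            by_contra hcon
            have := hjmin _ (hpredB n) (by omega)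
            have := hpredlt n (by omega)
            omega
          simpa using Finset.card_le_card hsub
        have hsz' : (s : ℝ) ≤ z i := by exact_mod_cast hsz
        have h5 : L ≤ 2 * C₈ * s := by
          rw [div_le_iff₀ (by positivity)] at hs1
          linarith
        have h6 : 2 * C₈ * s ≤ 2 * C₈ * z i := by gcongr
        linarith
  -- The gaps with left end in `I` cover the block `[N, 2N)`.
  have hfib : (N : ℝ) ≤ ∑ i ∈ I, ((j i : ℝ) - i) := by
    have h1 : (Finset.Ico N (2 * N)).card = ∑ i ∈ I,
        ((Finset.Ico N (2 * N)).filter (pred · = i)).card :=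
      Finset.card_eq_sum_card_image _ _
    rw [Nat.card_Ico] at h1
    have h2 : (N : ℝ) = ∑ i ∈ I, (((Finset.Ico N (2 * N)).filter (pred · = i)).card : ℝ) := by
      rw [← Nat.cast_sum, ← h1]
      congr 1
      omega
    rw [h2]
    refine Finset.sum_le_sum fun i _ => ?_
    obtain ⟨hjB, hij, hjmin⟩ := hj i
    have hsub : (Finset.Ico N (2 * N)).filter (pred · = i) ⊆ Finset.Ioc i (j i) := by
      intro n hn
      rw [Finset.mem_filter, Finset.mem_Ico] at hn
      rw [Finset.mem_Ioc]
      have := hpredlt n (by omega)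
      refine ⟨by omega, ?_⟩
      by_contra hcon
      exact absurd (hpredmax n _ hjB (by omega)) (by omega)
    have h3 := Finset.card_le_card hsub
    rw [Nat.card_Ioc] at h3
    rw [← Nat.cast_sub hij.le]
    exact_mod_cast h3
  have hIle : ∀ 𝒜 : Set ℕ, ((I.filter (· ∈ 𝒜)).card : ℝ) ≤ count 𝒜 ((2 * N : ℕ) : ℝ) := by
    intro 𝒜
    rw [count_natCast]
    refine Nat.cast_le.2 (Finset.card_le_card fun i hi => ?_)
    rw [Finset.mem_filter] at hi ⊢
    exact ⟨Finset.mem_range.2 (hIprop i hi.1).2.1, hi.2⟩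
  have hIle' : ∀ 𝒜 : Set ℕ, (∀ i ∈ I, i ∈ 𝒜) → (I.card : ℝ) ≤ count 𝒜 ((2 * N : ℕ) : ℝ) := by
    intro 𝒜 h𝒜
    have h := hIle 𝒜
    rwa [Finset.filter_true_of_mem h𝒜] at h
  have hA : ∑ i ∈ I, (if i ∈ E then (N : ℝ) / (16 * C * w N) else 0) ≤ N / 4 := by
    rw [← Finset.sum_filter, Finset.sum_const, nsmul_eq_mul]
    have h1 : ((I.filter (· ∈ E)).card : ℝ) ≤ C * (4 * w N) := by
      refine (hIle E).trans (hNE.trans ?_)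
      gcongr
      exact_mod_cast hNd
    calc _ ≤ C * (4 * w N) * (N / (16 * C * w N)) := by gcongr
      _ = N / 4 := by field_simp; norm_num
  have hIcard : (I.card : ℝ) ≤ C * (2 * (N : ℝ) ^ (1 - η)) := by
    refine (hIle' (B ∪ T) fun i hi => Or.inl (hIprop i hi).1).trans (hN2.trans ?_)
    gcongr
    exact_mod_cast hscale 2 (by norm_num)
  have hA' : ∑ i ∈ I, (2 * (ℓ N : ℝ) + c) ≤ N / 4 := by
    rw [Finset.sum_const, nsmul_eq_mul]
    have h1 : 2 * (ℓ N : ℝ) + c ≤ (N : ℝ) ^ η / (8 * C) := by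
      have h2 : c ≤ (N : ℝ) ^ η / (16 * C) := by
        rw [le_div_iff₀ (by positivity)]; linarith
      have h3 : (N : ℝ) ^ η / (8 * C) =
        2 * (1 / (32 * C) * (N : ℝ) ^ η) + (N : ℝ) ^ η / (16 * C) := by field_simp; norm_num
      linarith
    calc _ ≤ C * (2 * (N : ℝ) ^ (1 - η)) * ((N : ℝ) ^ η / (8 * C)) := by gcongr
      _ = ((N : ℝ) ^ (1 - η) * (N : ℝ) ^ η) / 4 := by field_simp; norm_num
      _ = N / 4 := by rw [hNη]
  have hzsum : ∑ i ∈ I, (z i : ℝ) ≤ (((Finset.range (4 * N)).filter Z).card : ℝ) := by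
    rw [← Nat.cast_sum]
    refine Nat.cast_le.2 ?_
    rw [← Finset.card_biUnion]
    · refine Finset.card_le_card fun n hn => ?_
      obtain ⟨i, -, hn⟩ := Finset.mem_biUnion.1 hn
      exact (Finset.mem_filter.1 hn).1
    · intro a _ b _ hab
      refine Finset.disjoint_left.2 fun n hn hn' => hab ?_
      rw [← (Finset.mem_filter.1 hn).2, ← (Finset.mem_filter.1 hn').2]
  have hZcard : (((Finset.range (4 * N)).filter Z).card : ℝ) ≤ N / (8 * C₈) := by
    have h1 := card_le_mul_count hNZ
    have h2 : count (B ∪ T) ((4 * N + ℓ N : ℕ) : ℝ) ≤ count (B ∪ T) ((5 * N : ℕ) : ℝ) := by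
      exact count_mono _ (by exact_mod_cast (by omega : 4 * N + ℓ N ≤ 5 * N))
    have h3 : (((Finset.range (4 * N)).filter Z).card : ℝ) ≤
        count (B ∪ T) ((5 * N : ℕ) : ℝ) * ℓ N := by
      exact_mod_cast h1.trans (Nat.mul_le_mul_right _ h2)
    calc _ ≤ _ := h3
      _ ≤ (C * ((5 : ℕ) * (N : ℝ) ^ (1 - η))) * (1 / (40 * C * C₈) * (N : ℝ) ^ η) := by
        gcongr
        refine hN5.trans ?_
        gcongr
        exact hscale 5 (by norm_num)
      _ = ((N : ℝ) ^ (1 - η) * (N : ℝ) ^ η) / (8 * C₈) := by push_cast; field_simp; norm_num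
      _ = N / (8 * C₈) := by rw [hNη]
  have hfinal := hfib.trans (Finset.sum_le_sum hlen)
  rw [Finset.sum_add_distrib, Finset.sum_add_distrib, ← Finset.mul_sum] at hfinal
  have h7 : 2 * C₈ * ∑ i ∈ I, (z i : ℝ) ≤ N / 4 := by
    calc _ ≤ 2 * C₈ * (N / (8 * C₈)) := by gcongr; exact hzsum.trans hZcard
      _ = N / 4 := by field_simp; norm_num
  -- Each of the three kinds of gap covers at most `N / 4`, too little for a block of length `N`.
  linarith

/-! ### Rescaled tails of a power series -/

theorem summable_succ_pow_mul_geometric {q : ℝ} (h0 : 0 < q) (h1 : q < 1) (P : ℕ) :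
    Summable fun l : ℕ => ((l : ℝ) + 1) ^ P * q ^ l := by
  have h := summable_pow_mul_geometric_of_norm_lt_one (R := ℝ) P (r := q)
    (by rwa [Real.norm_of_nonneg h0.le])
  refine (((summable_nat_add_iff 1).2 h).mul_left q⁻¹).congr fun l => ?_
  push_cast
  field_simp
  ring

section Tail

variable {q : ℝ} {G : ℕ → ℝ} {M : ℝ} {P : ℕ}

theorem norm_shift_le (hM : 0 ≤ M) (hq : 0 < q)
    (hG : ∀ m, |G m| ≤ M * ((m : ℝ) + 1) ^ P) (n l : ℕ) :
    ‖G (n + l) * q ^ l‖ ≤ M * ((n : ℝ) + 1) ^ P * (((l : ℝ) + 1) ^ P * q ^ l) := by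
  rw [norm_mul, Real.norm_eq_abs, Real.norm_of_nonneg (by positivity : 0 ≤ q ^ l)]
  have h : ((n + l : ℕ) : ℝ) + 1 ≤ (n + 1) * (l + 1) := by
    push_cast
    nlinarith [(by positivity : (0 : ℝ) ≤ (n : ℝ) * l)]
  calc |G (n + l)| * q ^ l ≤ M * (((n : ℝ) + 1) * (l + 1)) ^ P * q ^ l := by
        gcongr
        refine (hG _).trans ?_
        gcongr
    _ = _ := by rw [mul_pow]; ring

theorem summable_shift (hM : 0 ≤ M) (h0 : 0 < q) (h1 : q < 1)
    (hG : ∀ m, |G m| ≤ M * ((m : ℝ) + 1) ^ P) (n : ℕ) :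
    Summable fun l => G (n + l) * q ^ l :=
  Summable.of_norm_bounded ((summable_succ_pow_mul_geometric h0 h1 P).mul_left _)
    (norm_shift_le hM h0 hG n)

theorem abs_tsum_shift_le (hM : 0 ≤ M) (h0 : 0 < q) (h1 : q < 1)
    (hG : ∀ m, |G m| ≤ M * ((m : ℝ) + 1) ^ P) (n : ℕ) :
    |∑' l, G (n + l) * q ^ l| ≤
      M * (∑' l : ℕ, ((l : ℝ) + 1) ^ P * q ^ l) * ((n : ℝ) + 1) ^ P := by
  have h := tsum_of_norm_bounded
    (((summable_succ_pow_mul_geometric h0 h1 P).mul_left (M * ((n : ℝ) + 1) ^ P)).hasSum)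
    (norm_shift_le hM h0 hG n)
  rw [tsum_mul_left] at h
  rw [← Real.norm_eq_abs]
  refine h.trans_eq (by ring)

theorem tsum_shift_eq (hM : 0 ≤ M) (h0 : 0 < q) (h1 : q < 1)
    (hG : ∀ m, |G m| ≤ M * ((m : ℝ) + 1) ^ P) (n d : ℕ) :
    ∑' l, G (n + l) * q ^ l =
      ∑ l ∈ Finset.range d, G (n + l) * q ^ l + q ^ d * ∑' l, G (n + d + l) * q ^ l := by
  rw [← (summable_shift hM h0 h1 hG n).sum_add_tsum_nat_add d, ← tsum_mul_left]
  congr 1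
  refine tsum_congr fun l => ?_
  rw [pow_add, show n + (l + d) = n + d + l by ring]
  ring

end Tail

/-- A length `a * log N` with `a = (Q + 1) / (-log q)` makes `q ^ ℓ N` at most `N ^ (-(Q + 1))`, one
power more than needed to absorb the constant `K`. -/
theorem exists_logarithmic_length {q : ℝ} (h0 : 0 < q) (h1 : q < 1) (K : ℝ) (Q : ℕ) {η : ℝ}
    (hη : 0 < η) : ∃ ℓ : ℕ → ℕ, (∀ N, 1 ≤ ℓ N) ∧
      (∀ ε : ℝ, 0 < ε → ∀ᶠ N : ℕ in atTop, (ℓ N : ℝ) ≤ ε * (N : ℝ) ^ η) ∧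
      ∀ᶠ N : ℕ in atTop, K * (N : ℝ) ^ Q * q ^ ℓ N < 1 := by
  have hlq : 0 < -Real.log q := by have := Real.log_neg h0 h1; linarith
  set a : ℝ := (Q + 1) / (-Real.log q) with ha
  have ha0 : 0 < a := by positivity
  refine ⟨fun N => ⌈a * Real.log N⌉₊ + 1, fun N => Nat.le_add_left 1 _, fun ε hε => ?_, ?_⟩
  · have hlog : (fun N : ℕ => Real.log (N : ℝ)) =o[atTop] fun N : ℕ => (N : ℝ) ^ η :=
      (isLittleO_log_rpow_atTop hη).comp_tendsto tendsto_natCast_atTop_atTop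
    have hexp : Tendsto (fun N : ℕ => (N : ℝ) ^ η) atTop atTop :=
      (tendsto_rpow_atTop hη).comp tendsto_natCast_atTop_atTop
    filter_upwards [hlog.bound (show 0 < ε / (2 * a) by positivity),
      hexp.eventually_ge_atTop (4 / ε), eventually_ge_atTop 1] with N hN hN2 hN1
    have hlN : 0 ≤ Real.log N := Real.log_nonneg (by exact_mod_cast hN1)
    rw [Real.norm_of_nonneg hlN, Real.norm_of_nonneg (by positivity)] at hN
    have h2 := (Nat.ceil_lt_add_one (mul_nonneg ha0.le hlN)).le
    have h3 : a * Real.log N ≤ ε / 2 * (N : ℝ) ^ η := by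
      calc _ ≤ a * (ε / (2 * a) * (N : ℝ) ^ η) := by gcongr
        _ = _ := by field_simp
    rw [div_le_iff₀ hε] at hN2
    push_cast
    linarith
  · filter_upwards [tendsto_natCast_atTop_atTop.eventually_gt_atTop K,
      eventually_ge_atTop 1] with N hN hN1
    have hNpos : (0 : ℝ) < N := by exact_mod_cast hN1
    have h2 : q ^ (⌈a * Real.log N⌉₊ + 1) ≤ ((N : ℝ) ^ (Q + 1))⁻¹ := by
      rw [← Real.log_le_log_iff (by positivity) (by positivity), Real.log_pow, Real.log_inv,
        Real.log_pow]
      have h3 := Nat.le_ceil (a * Real.log N)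
      have h4 : a * (-Real.log q) = Q + 1 := div_mul_cancel₀ _ hlq.ne'
      push_cast
      have h5 : a * Real.log N * (-Real.log q) ≤
          ((⌈a * Real.log N⌉₊ : ℝ) + 1) * (-Real.log q) := by
        gcongr; linarith
      have h6 : a * Real.log N * (-Real.log q) = (Q + 1) * Real.log N := by
        rw [← h4]; ring
      linarith
    rcases le_or_gt K 0 with hK | hK
    · exact lt_of_le_of_lt (mul_nonpos_of_nonpos_of_nonneg
        (mul_nonpos_of_nonpos_of_nonneg hK (by positivity)) (by positivity)) one_pos
    · calc _ ≤ K * (N : ℝ) ^ Q * ((N : ℝ) ^ (Q + 1))⁻¹ := by gcongr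
        _ = K / N := by rw [pow_succ]; field_simp
        _ < 1 := by rwa [div_lt_one hNpos]

/-- A series with sparse coefficients, which are positive away from a set `B` with suitable gaps,
cannot vanish at `q` if its partial sums satisfy a Liouville type inequality. -/
theorem sparse_series_contradiction {q : ℝ} (hq0 : 0 < q) (hq1 : q < 1) {G : ℕ → ℝ}
    {B T E S : Set ℕ} {w : ℕ → ℕ} {η C C₈ C₉ M c₀ c₁ : ℝ} {P Q : ℕ}
    (hη : 0 < η) (hη' : η ≤ 1) (hC : 0 < C) (hC₈ : 0 < C₈) (h0 : 0 ∈ B)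
    (hcount : ∀ᶠ N : ℕ in atTop, (count (B ∪ T) N : ℝ) ≤ C * (N : ℝ) ^ (1 - η))
    (hE : ∀ᶠ N : ℕ in atTop, (count E N : ℝ) ≤ C * w N)
    (hw : ∀ᶠ N : ℕ in atTop, (w N : ℝ) ≤ C * (N : ℝ) ^ (1 - η))
    (hmono : Monotone w) (hpos : ∀ᶠ N : ℕ in atTop, 1 ≤ w N)
    (hgap : ∀ ε : ℝ, 0 < ε → ∀ᶠ n : ℕ in atTop,
      ∃ b ∈ B, b < n ∧ (n : ℝ) - b ≤ ε * (n / w n))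
    (hstep : ∀ i ∈ B, i ∉ E → ∀ s ∈ S, i + s ∈ B ∪ T)
    (hS : ∀ x : ℝ, C₉ ≤ x → ∃ s ∈ S, x ≤ (s : ℝ) ∧ (s : ℝ) ≤ C₈ * x)
    (hM : 0 ≤ M) (hG : ∀ m, |G m| ≤ M * ((m : ℝ) + 1) ^ P)
    (hsum : ∑' m, G m * q ^ m = 0)
    (hsupp : ∀ m, m ∉ B ∪ T → G m = 0) (hnonneg : ∀ m, m ∉ B → 0 ≤ G m)
    (hc₀ : 0 < c₀) (hT : ∀ m ∈ T, m ∉ B → c₀ ≤ G m)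
    (hc₁ : 0 < c₁) (harith : ∀ n : ℕ, ∑ m ∈ Finset.range n, G m * q ^ m ≠ 0 →
      c₁ * q ^ n ≤ |∑ m ∈ Finset.range n, G m * q ^ m| * ((n : ℝ) + 1) ^ Q) : False := by
  set X : ℕ → ℝ := fun n => ∑' l, G (n + l) * q ^ l with hX
  set V : ℝ := M * ∑' l : ℕ, ((l : ℝ) + 1) ^ P * q ^ l with hV
  have hV0 : 0 ≤ V := mul_nonneg hM (tsum_nonneg fun l => by positivity)
  have hXle : ∀ n, |X n| ≤ V * ((n : ℝ) + 1) ^ P := abs_tsum_shift_le hM hq0 hq1 hG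
  have hXeq : ∀ n d, X n = ∑ l ∈ Finset.range d, G (n + l) * q ^ l + q ^ d * X (n + d) :=
    tsum_shift_eq hM hq0 hq1 hG
  -- The full sum is zero, so the tail is minus the partial sum and inherits its lower bound.
  have hXar : ∀ n, X n ≠ 0 → c₁ ≤ |X n| * ((n : ℝ) + 1) ^ Q := by
    intro n hn
    have h2 : X 0 = 0 := by simpa [hX] using hsum
    have h3 := hXeq 0 n
    simp only [zero_add, h2] at h3
    have hpn : 0 < q ^ n := by positivity
    have h4 : ∑ m ∈ Finset.range n, G m * q ^ m = -(q ^ n * X n) := by linarith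
    have h5 := harith n (by rw [h4]; exact neg_ne_zero.2 (mul_ne_zero hpn.ne' hn))
    rw [h4, abs_neg, abs_mul, abs_of_pos hpn] at h5
    refine le_of_mul_le_mul_left (a := q ^ n) ?_ hpn
    linarith
  -- Large enough for both uses of `hℓq`, against `c₀` and against `c₁`; the 6 comes from `n + ℓ N +
  -- 1 ≤ 6 * N` for `n < 4 * N`.
  set K : ℝ := (V * 6 ^ P * 6 ^ Q + 1) * (1 / c₀ + 1 / c₁) with hK
  have hK₀ : V * 6 ^ P ≤ c₀ * K := by
    have h6 : (1 : ℝ) ≤ 6 ^ Q := one_le_pow₀ (by norm_num)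
    have h7 : V * 6 ^ P * 1 ≤ V * 6 ^ P * 6 ^ Q := by gcongr
    have : c₀ * K = (V * 6 ^ P * 6 ^ Q + 1) * (1 + c₀ / c₁) := by rw [hK]; field_simp
    rw [this]
    nlinarith [(by positivity : 0 ≤ V * 6 ^ P * 6 ^ Q), (by positivity : 0 ≤ c₀ / c₁),
      (by positivity : 0 ≤ (V * 6 ^ P * 6 ^ Q) * (c₀ / c₁))]
  have hK₁ : V * 6 ^ P * 6 ^ Q ≤ c₁ * K := by
    have : c₁ * K = (V * 6 ^ P * 6 ^ Q + 1) * (1 + c₁ / c₀) := by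
      rw [hK]; field_simp; ring
    rw [this]
    nlinarith [(by positivity : 0 ≤ V * 6 ^ P * 6 ^ Q), (by positivity : 0 ≤ c₁ / c₀),
      (by positivity : 0 ≤ (V * 6 ^ P * 6 ^ Q) * (c₁ / c₀))]
  obtain ⟨ℓ, hℓ1, hℓ, hℓq⟩ := exists_logarithmic_length hq0 hq1 K (P + Q) hη
  have hℓN : ∀ᶠ N : ℕ in atTop, ℓ N ≤ N := by
    filter_upwards [hℓ 1 one_pos, eventually_ge_atTop 1] with N hN hN1
    have : (N : ℝ) ^ η ≤ (N : ℝ) ^ (1 : ℝ) :=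
      Real.rpow_le_rpow_of_exponent_le (by exact_mod_cast hN1) hη'
    rw [Real.rpow_one] at this
    have h2 : (ℓ N : ℝ) ≤ N := by linarith
    exact_mod_cast h2
  refine counting_contradiction (Z := fun n => X n ≠ 0) (ℓ := ℓ) hη hη' hC hC₈ h0 hcount hE hw
    hmono hpos hgap hstep hS hℓ ?_ ?_
  -- If `G` vanished on the next `ℓ N` places, `X n` would be `q ^ ℓ N` times a polynomially bounded
  -- quantity, hence below its arithmetic lower bound.
  · filter_upwards [hℓN, hℓq, eventually_ge_atTop 1] with N hN hNq hN1 n hn hXn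
    have hN1' : (1 : ℝ) ≤ N := by exact_mod_cast hN1
    by_contra! hcon
    have h1 := hXeq n (ℓ N)
    rw [Finset.sum_eq_zero, zero_add] at h1
    · have h2 := hXar n hXn
      have h3 := hXle (n + ℓ N)
      have h4 : ((n + ℓ N : ℕ) : ℝ) + 1 ≤ 6 * N := by
        exact_mod_cast (by omega : n + ℓ N + 1 ≤ 6 * N)
      have h5 : ((n : ℕ) : ℝ) + 1 ≤ 6 * N := by exact_mod_cast (by omega : n + 1 ≤ 6 * N)
      rw [h1, abs_mul, abs_of_pos (by positivity)] at h2
      have h6 : q ^ ℓ N * |X (n + ℓ N)| * ((n : ℝ) + 1) ^ Q ≤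
          q ^ ℓ N * (V * (6 * N) ^ P) * (6 * N) ^ Q := by
        gcongr
        exact h3.trans (by gcongr)
      have h7 : q ^ ℓ N * (V * (6 * N) ^ P) * (6 * N) ^ Q ≤
          c₁ * (K * (N : ℝ) ^ (P + Q) * q ^ ℓ N) := by
        calc _ = (V * 6 ^ P * 6 ^ Q) * ((N : ℝ) ^ (P + Q) * q ^ ℓ N) := by
              rw [mul_pow, mul_pow, pow_add]; ring
          _ ≤ (c₁ * K) * ((N : ℝ) ^ (P + Q) * q ^ ℓ N) := by gcongr
          _ = _ := by ring
      nlinarith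
    · intro l hl
      rw [hsupp, zero_mul]
      intro hmem
      have := hcon _ hmem (by omega)
      have := Finset.mem_range.1 hl
      omega
  -- Inside the gap all terms are nonnegative and the one at `p` is at least `c₀ * q ^ (p - n)`; the
  -- part from `j` on, being `ℓ N` further away, is too small to cancel it.
  · filter_upwards [hℓN, hℓq, eventually_ge_atTop 1] with N hN hNq hN1 i p j hj4 hjmin hpT hip hpj
      n hin hnp
    have hℓ1 := hℓ1 N
    have hN1' : (1 : ℝ) ≤ N := by exact_mod_cast hN1
    have hnB : ∀ m, i < m → m < j → m ∉ B := fun m h1 h2 h3 =>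
      absurd (hjmin m h3 h1) (by omega)
    have h1 := hXeq n (j - n)
    rw [show n + (j - n) = j by omega] at h1
    have h2 : c₀ * q ^ (p - n) ≤ ∑ l ∈ Finset.range (j - n), G (n + l) * q ^ l := by
      have h3 := Finset.single_le_sum (s := Finset.range (j - n))
        (f := fun l => G (n + l) * q ^ l) (fun l hl => mul_nonneg (hnonneg _ (hnB _ (by omega) (by
          have := Finset.mem_range.1 hl; omega))) (by positivity))
        (Finset.mem_range.2 (by omega : p - n < j - n))
      refine le_trans ?_ h3
      rw [show n + (p - n) = p by omega]
      gcongr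
      exact hT p hpT (hnB p hip (by omega))
    have h4 : |q ^ (j - n) * X j| < c₀ * q ^ (p - n) := by
      have h5 : q ^ (j - n) ≤ q ^ (p - n) * q ^ ℓ N := by
        rw [← pow_add]
        exact pow_le_pow_of_le_one hq0.le hq1.le (by omega)
      have h6 : (j : ℝ) + 1 ≤ 6 * N := by exact_mod_cast (by omega : j + 1 ≤ 6 * N)
      rw [abs_mul, abs_of_pos (by positivity)]
      calc _ ≤ (q ^ (p - n) * q ^ ℓ N) * (V * (6 * N) ^ P) := by
            gcongr
            exact (hXle j).trans (by gcongr)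
        _ = (V * 6 ^ P) * ((N : ℝ) ^ P * q ^ ℓ N * q ^ (p - n)) := by rw [mul_pow]; ring
        _ ≤ (c₀ * K) * ((N : ℝ) ^ (P + Q) * q ^ ℓ N * q ^ (p - n)) := by
            gcongr
            exact Nat.le_add_right P Q
        _ = (K * (N : ℝ) ^ (P + Q) * q ^ ℓ N) * (c₀ * q ^ (p - n)) := by ring
        _ < 1 * (c₀ * q ^ (p - n)) := by gcongr
        _ = _ := one_mul _
    have h7 := neg_abs_le (q ^ (j - n) * X j)
    exact ne_of_gt (by linarith)

/-! ### Supports of products -/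

section Support

open scoped Pointwise

/-- Power series with nonnegative coefficients of at most polynomial growth. -/
def Tame (f : PowerSeries ℤ) : Prop :=
  (∀ n, 0 ≤ PowerSeries.coeff n f) ∧
    ∃ (M : ℝ) (P : ℕ), 0 ≤ M ∧ ∀ n, ((PowerSeries.coeff n f : ℤ) : ℝ) ≤ M * ((n : ℝ) + 1) ^ P

theorem Tame.one : Tame 1 := by
  refine ⟨fun n => ?_, 1, 0, zero_le_one, fun n => ?_⟩
  · rw [PowerSeries.coeff_one]; split_ifs <;> norm_num
  · rw [PowerSeries.coeff_one]; split_ifs <;> norm_num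

theorem Tame.mul {f g : PowerSeries ℤ} (hf : Tame f) (hg : Tame g) : Tame (f * g) := by
  obtain ⟨hf0, M, P, hM, hf⟩ := hf
  obtain ⟨hg0, M', P', hM', hg⟩ := hg
  refine ⟨fun n => ?_, M * M', P + P' + 1, mul_nonneg hM hM', fun n => ?_⟩
  · rw [PowerSeries.coeff_mul]
    exact Finset.sum_nonneg fun x _ => mul_nonneg (hf0 _) (hg0 _)
  · rw [PowerSeries.coeff_mul]
    push_cast
    have h1 : ∀ x ∈ Finset.HasAntidiagonal.antidiagonal n,
        ((PowerSeries.coeff x.1 f : ℤ) : ℝ) * ((PowerSeries.coeff x.2 g : ℤ) : ℝ) ≤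
          (M * ((n : ℝ) + 1) ^ P) * (M' * ((n : ℝ) + 1) ^ P') := by
      intro x hx
      have hx' := Finset.HasAntidiagonal.mem_antidiagonal.1 hx
      have h1 : (x.1 : ℝ) ≤ n := by exact_mod_cast (by omega : x.1 ≤ n)
      have h2 : (x.2 : ℝ) ≤ n := by exact_mod_cast (by omega : x.2 ≤ n)
      have h3 : (0 : ℝ) ≤ (PowerSeries.coeff x.2 g : ℤ) := by exact_mod_cast hg0 _
      gcongr
      · exact (hf _).trans (by gcongr)
      · exact (hg _).trans (by gcongr)
    refine (Finset.sum_le_sum h1).trans_eq ?_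
    rw [Finset.sum_const, Finset.Nat.card_antidiagonal, nsmul_eq_mul]
    push_cast
    ring

theorem Tame.pow {f : PowerSeries ℤ} (hf : Tame f) (n : ℕ) : Tame (f ^ n) := by
  induction n with
  | zero => rw [pow_zero]; exact Tame.one
  | succ n ih => rw [pow_succ]; exact ih.mul hf

theorem Tame.prod {ι : Type*} (s : Finset ι) {f : ι → PowerSeries ℤ} (hf : ∀ i, Tame (f i)) :
    Tame (∏ i ∈ s, f i) :=
  Finset.prod_induction f Tame (fun _ _ => Tame.mul) Tame.one fun i _ => hf i

theorem Tame.summable {f : PowerSeries ℤ} (hf : Tame f) {q : ℝ} (h0 : 0 < q) (h1 : q < 1) :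
    Summable fun n : ℕ => ((PowerSeries.coeff n f : ℤ) : ℝ) * q ^ n := by
  obtain ⟨hf0, M, P, hM, hf⟩ := hf
  have h := summable_shift (G := fun n => ((PowerSeries.coeff n f : ℤ) : ℝ)) (M := M) (P := P)
    hM h0 h1 (fun m => by rw [abs_of_nonneg (by exact_mod_cast hf0 m)]; exact hf m) 0
  simpa using h

theorem value_one (q : ℝ) : value 1 q = 1 := by
  rw [value, tsum_eq_single 0]
  · simp
  · intro n hn
    simp [PowerSeries.coeff_one, hn]

theorem value_mul {f g : PowerSeries ℤ} (hf : Tame f) (hg : Tame g) {q : ℝ} (h0 : 0 < q)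
    (h1 : q < 1) : value (f * g) q = value f q * value g q := by
  rw [value, value, value, tsum_mul_tsum_eq_tsum_sum_antidiagonal_of_summable_norm
    (hf.summable h0 h1).norm (hg.summable h0 h1).norm]
  refine tsum_congr fun n => ?_
  rw [PowerSeries.coeff_mul]
  push_cast
  rw [Finset.sum_mul]
  refine Finset.sum_congr rfl fun x hx => ?_
  rw [← Finset.HasAntidiagonal.mem_antidiagonal.1 hx, pow_add]
  ring

theorem value_pow {f : PowerSeries ℤ} (hf : Tame f) {q : ℝ} (h0 : 0 < q) (h1 : q < 1) (n : ℕ) :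
    value (f ^ n) q = value f q ^ n := by
  induction n with
  | zero => rw [pow_zero, pow_zero, value_one]
  | succ n ih => rw [pow_succ, pow_succ, value_mul (hf.pow n) hf h0 h1, ih]

theorem value_prod {ι : Type*} (s : Finset ι) {f : ι → PowerSeries ℤ} (hf : ∀ i, Tame (f i))
    {q : ℝ} (h0 : 0 < q) (h1 : q < 1) : value (∏ i ∈ s, f i) q = ∏ i ∈ s, value (f i) q := by
  classical
  induction s using Finset.induction_on with
  | empty => rw [Finset.prod_empty, Finset.prod_empty, value_one]
  | insert a s ha ih =>
    rw [Finset.prod_insert ha, Finset.prod_insert ha, value_mul (hf a) (Tame.prod s hf) h0 h1, ih]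

theorem supp_one : supp 1 = 0 := by
  ext n
  simp [supp, PowerSeries.coeff_one]

/-- Nonnegative coefficients rule out cancellation in the Cauchy product. -/
theorem supp_mul {f g : PowerSeries ℤ} (hf : Tame f) (hg : Tame g) :
    supp (f * g) = supp f + supp g := by
  ext n
  rw [Set.mem_add]
  simp only [supp, Set.mem_ofPred_eq, PowerSeries.coeff_mul]
  rw [Ne, Finset.sum_eq_zero_iff_of_nonneg fun x _ => mul_nonneg (hf.1 _) (hg.1 _)]
  push Not
  constructor
  · rintro ⟨x, hx, hne⟩
    exact ⟨x.1, left_ne_zero_of_mul hne, x.2, right_ne_zero_of_mul hne,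
      Finset.HasAntidiagonal.mem_antidiagonal.1 hx⟩
  · rintro ⟨a, ha, b, hb, hab⟩
    exact ⟨(a, b), Finset.HasAntidiagonal.mem_antidiagonal.2 hab, mul_ne_zero ha hb⟩

theorem supp_pow {f : PowerSeries ℤ} (hf : Tame f) (n : ℕ) : supp (f ^ n) = n • supp f := by
  induction n with
  | zero => rw [pow_zero, zero_nsmul, supp_one]
  | succ n ih => rw [pow_succ, supp_mul (hf.pow n) hf, ih, succ_nsmul]

theorem supp_prod {ι : Type*} (s : Finset ι) {f : ι → PowerSeries ℤ} (hf : ∀ i, Tame (f i)) :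
    supp (∏ i ∈ s, f i) = ∑ i ∈ s, supp (f i) := by
  classical
  induction s using Finset.induction_on with
  | empty => rw [Finset.prod_empty, Finset.sum_empty, supp_one]
  | insert a s ha ih =>
    rw [Finset.prod_insert ha, Finset.sum_insert ha, supp_mul (hf a) (Tame.prod s hf), ih]

theorem nfold_eq_nsmul (k : ℕ) (𝒜 : Set ℕ) : nfold k 𝒜 = k • 𝒜 := by
  ext n
  rw [Set.mem_nsmul_iff_sum]
  simp only [nfold, Set.mem_ofPred_eq, eq_comm]

theorem minkowski_eq_sum {r : ℕ} (k : Fin r → ℕ) (𝒜 : Fin r → Set ℕ) :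
    minkowski k 𝒜 = ∑ h, k h • 𝒜 h := by
  ext n
  rw [Set.mem_fintype_sum]
  simp only [minkowski, Set.mem_ofPred_eq, nfold_eq_nsmul, exists_prop, eq_comm]

theorem finite_lt (𝒜 : Set ℕ) (x : ℝ) : {n : ℕ | n ∈ 𝒜 ∧ (n : ℝ) < x}.Finite :=
  (Set.finite_Iio ⌈x⌉₊).subset fun _ hn => Nat.lt_ceil.2 hn.2

theorem count_zero_le (x : ℝ) : count 0 x ≤ 1 := by
  refine (Set.ncard_le_ncard (t := {0}) (fun n hn => hn.1) (Set.finite_singleton _)).trans ?_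
  simp

theorem count_add_le (𝒜 ℬ : Set ℕ) (x : ℝ) : count (𝒜 + ℬ) x ≤ count 𝒜 x * count ℬ x := by
  rw [count, count, count, ← Set.ncard_prod]
  refine (Set.ncard_le_ncard (t := (fun p : ℕ × ℕ => p.1 + p.2) ''
    ({n : ℕ | n ∈ 𝒜 ∧ (n : ℝ) < x} ×ˢ {n : ℕ | n ∈ ℬ ∧ (n : ℝ) < x})) ?_ ?_).trans
    (Set.ncard_image_le ((finite_lt 𝒜 x).prod (finite_lt ℬ x)))
  · rintro n ⟨⟨a, ha, b, hb, rfl⟩, hn⟩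
    have hn' : ((a + b : ℕ) : ℝ) < x := hn
    push_cast at hn'
    have ha0 : (0 : ℝ) ≤ a := by positivity
    have hb0 : (0 : ℝ) ≤ b := by positivity
    exact ⟨(a, b), ⟨⟨ha, show (a : ℝ) < x by linarith⟩, hb, show (b : ℝ) < x by linarith⟩, rfl⟩
  · exact ((finite_lt 𝒜 x).prod (finite_lt ℬ x)).image _

theorem count_nsmul_le (𝒜 : Set ℕ) (x : ℝ) (k : ℕ) : count (k • 𝒜) x ≤ count 𝒜 x ^ k := by
  induction k with
  | zero => rw [zero_nsmul, pow_zero]; exact count_zero_le x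
  | succ k ih =>
    rw [succ_nsmul, pow_succ]
    exact (count_add_le _ _ x).trans (Nat.mul_le_mul_right _ ih)

theorem count_sum_le {ι : Type*} (s : Finset ι) (𝒜 : ι → Set ℕ) (x : ℝ) :
    count (∑ i ∈ s, 𝒜 i) x ≤ ∏ i ∈ s, count (𝒜 i) x := by
  classical
  induction s using Finset.induction_on with
  | empty => rw [Finset.sum_empty, Finset.prod_empty]; exact count_zero_le x
  | insert a s ha ih =>
    rw [Finset.sum_insert ha, Finset.prod_insert ha]
    exact (count_add_le _ _ x).trans (Nat.mul_le_mul_left _ ih)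

theorem count_biUnion_le {ι : Type*} (s : Finset ι) (𝒜 : ι → Set ℕ) (x : ℝ) :
    count (⋃ i ∈ s, 𝒜 i) x ≤ ∑ i ∈ s, count (𝒜 i) x := by
  classical
  induction s using Finset.induction_on with
  | empty => simp [count]
  | insert a s ha ih =>
    rw [Finset.set_biUnion_insert, Finset.sum_insert ha]
    refine le_trans ?_ (Nat.add_le_add_left ih _)
    rw [count, count, count]
    refine le_trans (Set.ncard_le_ncard ?_ ((finite_lt _ x).union (finite_lt _ x)))
      (Set.ncard_union_le _ _)
    rintro n ⟨hn | hn, hx⟩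
    · exact Or.inl ⟨hn, hx⟩
    · exact Or.inr ⟨hn, hx⟩

/-- The product of powers of the series `f i`. -/
noncomputable def monom {r : ℕ} (f : Fin r → PowerSeries ℤ) (k : Fin r → ℕ) : PowerSeries ℤ :=
  ∏ i, f i ^ k i

section Monom

variable {r : ℕ} {f : Fin r → PowerSeries ℤ}

theorem tame_monom (hf : ∀ i, Tame (f i)) (k : Fin r → ℕ) : Tame (monom f k) :=
  Tame.prod _ fun i => (hf i).pow _

theorem monom_add (k l : Fin r → ℕ) : monom f (k + l) = monom f k * monom f l := by
  simp only [monom, Pi.add_apply, pow_add, Finset.prod_mul_distrib]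

theorem monom_single (i : Fin r) : monom f (Pi.single i 1) = f i := by
  rw [monom, Finset.prod_eq_single i]
  · simp
  · intro j _ hj
    simp [Pi.single_eq_of_ne hj]
  · simp

theorem value_monom (hf : ∀ i, Tame (f i)) {q : ℝ} (h0 : 0 < q) (h1 : q < 1) (k : Fin r → ℕ) :
    value (monom f k) q = ∏ i, value (f i) q ^ k i := by
  rw [monom, value_prod _ (fun i => (hf i).pow _) h0 h1]
  exact Finset.prod_congr rfl fun i _ => value_pow (hf i) h0 h1 _

theorem supp_monom (hf : ∀ i, Tame (f i)) (k : Fin r → ℕ) :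
    supp (monom f k) = minkowski k fun h => supp (f h) := by
  rw [monom, supp_prod _ (fun i => (hf i).pow _), minkowski_eq_sum]
  exact Finset.sum_congr rfl fun i _ => supp_pow (hf i) _

theorem count_supp_monom_le (hf : ∀ i, Tame (f i)) (k : Fin r → ℕ) (x : ℝ) :
    count (supp (monom f k)) x ≤ ∏ h, count (supp (f h)) x ^ k h := by
  rw [supp_monom hf, minkowski_eq_sum]
  exact (count_sum_le _ _ x).trans (Finset.prod_le_prod' fun i _ => count_nsmul_le _ x _)

end Monom

theorem supp_infinite {f : PowerSeries ℤ} (hf : IsNonpolynomial f) : (supp f).Infinite := by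
  intro hfin
  obtain ⟨N, hN⟩ := hfin.bddAbove
  refine hf (PowerSeries.trunc (N + 1) f) ?_
  ext n
  rw [Polynomial.coeff_coe, PowerSeries.coeff_trunc]
  split_ifs with h
  · rfl
  · by_contra hne
    exact absurd (hN (show n ∈ supp f from fun h0 => hne h0.symm)) (by omega)

end Support

/-! ### Comparison of the counting functions -/

section Growth

variable {r : ℕ} {a : Fin r → ℕ → ℕ}

theorem eventually_pow_le (hpos : ∀ i, ∀ᶠ N in atTop, 1 ≤ a i N)
    (h : ∀ i j : Fin r, j.val = i.val + 1 → ∀ ε : ℝ, 0 < ε →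
      (fun N : ℕ => (a j N : ℝ)) =o[atTop] fun N : ℕ => (a i N : ℝ) ^ ε)
    {i j : Fin r} (hij : i < j) (M : ℕ) : ∀ᶠ N in atTop, a j N ^ M ≤ a i N := by
  have hstep : ∀ i j : Fin r, j.val = i.val + 1 → ∀ M : ℕ, ∀ᶠ N in atTop, a j N ^ M ≤ a i N := by
    intro i j hij M
    filter_upwards [(h i j hij (1 / ((M : ℝ) + 1)) (by positivity)).bound one_pos, hpos i,
      hpos j] with N hN h1 h2
    rw [one_mul, Real.norm_of_nonneg (by positivity), Real.norm_of_nonneg (by positivity)] at hN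
    refine (Nat.pow_le_pow_right h2 (Nat.le_succ M)).trans ?_
    have h3 : (a j N : ℝ) ^ (M + 1) ≤ a i N := by
      calc _ ≤ ((a i N : ℝ) ^ (1 / ((M : ℝ) + 1))) ^ (M + 1) := by gcongr
        _ = a i N := by
          rw [← Real.rpow_natCast, ← Real.rpow_mul (by positivity)]
          push_cast
          rw [one_div_mul_cancel (by positivity), Real.rpow_one]
    exact_mod_cast h3
  obtain ⟨d, hd⟩ := Nat.exists_eq_add_of_lt (Fin.lt_def.1 hij)
  induction d generalizing j M with
  | zero => exact hstep i j hd M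
  | succ d ih =>
    have hlt := j.isLt
    filter_upwards [hstep ⟨i + d + 1, by omega⟩ j (by simp only; omega) M,
      ih (j := ⟨i + d + 1, by omega⟩) (Fin.lt_def.2 (by simp only; omega)) 1 rfl] with N h1 h2
    rw [pow_one] at h2
    exact h1.trans h2

theorem eventually_tail_prod_pow_le (hpos : ∀ i, ∀ᶠ N in atTop, 1 ≤ a i N)
    (h : ∀ i j : Fin r, i < j → ∀ M : ℕ, ∀ᶠ N in atTop, a j N ^ M ≤ a i N) (i : Fin r) (M : ℕ)
    (k : Fin r → ℕ) :
    ∀ᶠ N in atTop, (∏ j ∈ Finset.univ.filter (i < ·), a j N ^ k j) ^ M ≤ a i N := by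
  have hall : ∀ᶠ N in atTop, ∀ j, i < j → a j N ^ (k j * M * r) ≤ a i N := by
    refine eventually_all.2 fun j => ?_
    by_cases hij : i < j
    · filter_upwards [h i j hij (k j * M * r)] with N hN _ using hN
    · exact Eventually.of_forall fun N hij' => absurd hij' hij
  filter_upwards [hall, hpos i] with N hN h1
  have hr : r ≠ 0 := by have := i.isLt; omega
  -- After raising to the power `r`, each of the at most `r` factors is bounded by `a i N`
  -- separately.
  refine (Nat.pow_le_pow_iff_left hr).1 ?_
  rw [← Finset.prod_pow, ← Finset.prod_pow]
  calc _ ≤ ∏ j ∈ Finset.univ.filter (i < ·), a i N := by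
        refine Finset.prod_le_prod' fun j hj => ?_
        rw [← pow_mul, ← pow_mul, ← mul_assoc]
        exact hN j (Finset.mem_filter.1 hj).2
    _ = a i N ^ (Finset.univ.filter (i < ·)).card := Finset.prod_const _
    _ ≤ a i N ^ r := Nat.pow_le_pow_right h1 ((Finset.card_le_univ _).trans (by simp))

/-- One extra factor `a i N` outweighs every product of powers of the later functions. -/
theorem eventually_prod_le_of_lex (hpos : ∀ i, ∀ᶠ N in atTop, 1 ≤ a i N)
    (h : ∀ i j : Fin r, i < j → ∀ M : ℕ, ∀ᶠ N in atTop, a j N ^ M ≤ a i N) {k K : Fin r → ℕ}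
    (i : Fin r) (hlt : ∀ j < i, k j ≤ K j) (hi : k i < K i) :
    ∀ᶠ N in atTop, ∏ j, a j N ^ k j ≤ ∏ j, a j N ^ K j := by
  filter_upwards [eventually_tail_prod_pow_le hpos h i 1 k, eventually_all.2 hpos] with N hN h1
  rw [pow_one] at hN
  rw [← Finset.prod_filter_mul_prod_filter_not Finset.univ (i < ·),
    ← Finset.prod_filter_mul_prod_filter_not Finset.univ (i < ·) fun j => a j N ^ K j, mul_comm]
  have h2 : (∏ j ∈ Finset.univ.filter (¬ i < ·), a j N ^ k j) * a i N =
      ∏ j ∈ Finset.univ.filter (¬ i < ·), a j N ^ (k j + Pi.single (M := fun _ => ℕ) i 1 j) := by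
    simp only [pow_add, Finset.prod_mul_distrib]
    congr 1
    rw [Finset.prod_eq_single i]
    · simp
    · intro j _ hj
      simp [Pi.single_eq_of_ne hj]
    · simp
  calc _ ≤ (∏ j ∈ Finset.univ.filter (¬ i < ·), a j N ^ k j) * a i N := Nat.mul_le_mul_left _ hN
    _ ≤ ∏ j ∈ Finset.univ.filter (¬ i < ·), a j N ^ K j := by
      rw [h2]
      refine Finset.prod_le_prod' fun j hj => Nat.pow_le_pow_right (h1 j) ?_
      rcases lt_or_eq_of_le (not_lt.1 (Finset.mem_filter.1 hj).2) with hj' | rfl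
      · rw [Pi.single_eq_of_ne hj'.ne]
        exact hlt j hj'
      · simpa using hi
    _ ≤ _ := Nat.le_mul_of_pos_left _ (Finset.prod_pos fun j _ => Nat.pow_pos (h1 j))

theorem exists_eventually_prod_le_rpow (hpos : ∀ i, ∀ᶠ N in atTop, 1 ≤ a i N)
    (h : ∀ i j : Fin r, i < j → ∀ M : ℕ, ∀ᶠ N in atTop, a j N ^ M ≤ a i N)
    {A : ℕ} (hA : 1 ≤ A) (i : Fin r) (hi : i.val = 0) {δ : ℝ} (hδ : 0 < δ)
    (h0 : (fun N : ℕ => (a i N : ℝ)) =o[atTop] fun N : ℕ => (N : ℝ) ^ (-δ + 1 / (A : ℝ))) :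
    ∃ η : ℝ, 0 < η ∧ η ≤ 1 ∧ ∀ k : Fin r → ℕ, k i ≤ A →
      ∀ᶠ N : ℕ in atTop, ((∏ j, a j N ^ k j : ℕ) : ℝ) ≤ (N : ℝ) ^ (1 - η) := by
  have hA0 : (0 : ℝ) < A := by exact_mod_cast hA
  -- The leading factor contributes at most `N ^ (1 - A * δ)`; the later ones together cost less
  -- than `N ^ (A * δ / 2)`.
  refine ⟨min 1 (A * δ / 2), by positivity, min_le_left _ _, fun k hk => ?_⟩
  obtain ⟨M, hM⟩ := exists_nat_one_div_lt (show 0 < A * δ / 2 by positivity)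
  filter_upwards [eventually_tail_prod_pow_le hpos h i (M + 1) k, h0.bound one_pos, hpos i,
    eventually_ge_atTop 1] with N hN hN0 hai hN1
  have hN1' : (1 : ℝ) ≤ N := by exact_mod_cast hN1
  have hNpos : (0 : ℝ) < N := by linarith
  rw [one_mul, Real.norm_of_nonneg (by positivity), Real.norm_of_nonneg (by positivity)] at hN0
  set Q := ∏ j ∈ Finset.univ.filter (i < ·), a j N ^ k j with hQ
  have hprod : ∏ j, a j N ^ k j = a i N ^ k i * Q := by
    rw [← Finset.mul_prod_erase Finset.univ _ (Finset.mem_univ i), hQ]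
    congr 1
    refine Finset.prod_congr ?_ fun _ _ => rfl
    ext j
    simp only [Finset.mem_erase, Finset.mem_univ, and_true, Finset.mem_filter, true_and, Fin.lt_def,
      Ne, Fin.ext_iff]
    omega
  have haN : (a i N : ℝ) ≤ N := by
    refine hN0.trans ?_
    calc (N : ℝ) ^ (-δ + 1 / (A : ℝ)) ≤ (N : ℝ) ^ (1 : ℝ) := by
          refine Real.rpow_le_rpow_of_exponent_le hN1' ?_
          have : 1 / (A : ℝ) ≤ 1 := by
            rw [div_le_one hA0]; exact_mod_cast hA
          linarith
      _ = N := Real.rpow_one _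
  have hQle : (Q : ℝ) ≤ (N : ℝ) ^ (1 / ((M : ℝ) + 1)) := by
    refine le_of_pow_le_pow_left₀ (Nat.succ_ne_zero M) (by positivity) ?_
    rw [← Real.rpow_natCast ((N : ℝ) ^ _), ← Real.rpow_mul hNpos.le]
    push_cast
    rw [one_div_mul_cancel (by positivity), Real.rpow_one]
    exact le_trans (by exact_mod_cast hN) haN
  have hale : (a i N : ℝ) ^ k i ≤ (N : ℝ) ^ (1 - A * δ) := by
    calc (a i N : ℝ) ^ k i ≤ (a i N : ℝ) ^ A := by
          gcongr
          exact_mod_cast hai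
      _ ≤ ((N : ℝ) ^ (-δ + 1 / (A : ℝ))) ^ A := by gcongr
      _ = (N : ℝ) ^ (1 - A * δ) := by
        rw [← Real.rpow_natCast, ← Real.rpow_mul hNpos.le]
        congr 1
        field_simp
        ring
  rw [hprod]
  push_cast
  calc _ ≤ (N : ℝ) ^ (1 - A * δ) * (N : ℝ) ^ (1 / ((M : ℝ) + 1)) := by gcongr
    _ = (N : ℝ) ^ (1 - A * δ + 1 / ((M : ℝ) + 1)) := (Real.rpow_add hNpos _ _).symm
    _ ≤ _ := by
      refine Real.rpow_le_rpow_of_exponent_le hN1' ?_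
      have := min_le_right 1 (A * δ / 2)
      linarith

end Growth

/-! ### Liouville inequality in `ℚ⟮β⟯` -/

theorem one_le_prod_embeddings {K : Type*} [Field K] [NumberField K] {x : K} (hx : IsIntegral ℤ x)
    (hx0 : x ≠ 0) : 1 ≤ ∏ σ : K →ₐ[ℚ] ℂ, ‖σ x‖ := by
  obtain ⟨z, hz⟩ := IsIntegrallyClosed.isIntegral_iff.1 (Algebra.isIntegral_norm ℚ hx)
  have hz0 : z ≠ 0 := by
    rintro rfl
    rw [map_zero] at hz
    exact hx0 (Algebra.norm_eq_zero_iff.1 hz.symm)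
  have h := Algebra.norm_eq_prod_embeddings ℚ ℂ x
  rw [← norm_prod, ← h, ← hz]
  simp only [eq_intCast, map_intCast, Complex.norm_intCast]
  exact_mod_cast Int.one_le_abs hz0

/-- The weak bound on conjugates suffices: their powers need only stay bounded, so Pisot and Salem
numbers are treated alike. -/
theorem conj_norm_le_of_isPisot_or_isSalem {β : ℝ} (h : IsPisot β ∨ IsSalem β) :
    IsIntegral ℤ β ∧ 1 < β ∧ ∀ z ∈ (minpoly ℚ β).rootSet ℂ, z ≠ (β : ℂ) → ‖z‖ ≤ 1 := by
  rcases h with ⟨h1, h2, h3⟩ | ⟨h1, h2, h3, -⟩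
  · exact ⟨h1, h2, fun z hz hne => (h3 z hz hne).le⟩
  · exact ⟨h1, h2, h3⟩

section Liouville

variable {β : ℝ}

/-- The inclusion of `ℚ(β)` into the complex numbers. -/
noncomputable def incl (β : ℝ) : ℚ⟮β⟯ →ₐ[ℚ] ℂ :=
  (Complex.ofRealAm.restrictScalars ℚ).comp (IntermediateField.val ℚ⟮β⟯)

theorem incl_apply (x : ℚ⟮β⟯) : incl β x = ((x : ℝ) : ℂ) := rfl

theorem norm_embedding_gen_le (hβ : IsIntegral ℤ β)
    (hconj : ∀ z ∈ (minpoly ℚ β).rootSet ℂ, z ≠ (β : ℂ) → ‖z‖ ≤ 1) (σ : ℚ⟮β⟯ →ₐ[ℚ] ℂ)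
    (hσ : σ ≠ incl β) : ‖σ (IntermediateField.AdjoinSimple.gen ℚ β)‖ ≤ 1 := by
  have hint : IsIntegral ℚ β := hβ.tower_top
  refine hconj _ ?_ fun heq => hσ ?_
  · rw [Polynomial.mem_rootSet]
    refine ⟨minpoly.ne_zero hint, ?_⟩
    rw [Polynomial.aeval_algHom_apply]
    have : Polynomial.aeval (IntermediateField.AdjoinSimple.gen ℚ β) (minpoly ℚ β) = 0 :=
      IntermediateField.aeval_gen_minpoly ℚ β
    rw [this, map_zero]
  · refine IntermediateField.adjoin_algHom_ext ℚ fun x hx => ?_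
    obtain rfl := Set.mem_singleton_iff.1 hx
    exact heq

/-- An algebraic integer of `ℚ(β)` whose nontrivial conjugates have modulus at most `H` is zero or
not much smaller than a negative power of `H`. -/
theorem liouville [NumberField ℚ⟮β⟯] {x : ℚ⟮β⟯} (hx : IsIntegral ℤ x) (hx0 : x ≠ 0) {H : ℝ}
    (hH : ∀ σ : ℚ⟮β⟯ →ₐ[ℚ] ℂ, σ ≠ incl β → ‖σ x‖ ≤ H) :
    1 ≤ |(x : ℝ)| * H ^ (Fintype.card (ℚ⟮β⟯ →ₐ[ℚ] ℂ) - 1) := by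
  classical
  refine (one_le_prod_embeddings hx hx0).trans ?_
  rw [← Finset.mul_prod_erase Finset.univ _ (Finset.mem_univ (incl β)), incl_apply,
    Complex.norm_real, Real.norm_eq_abs]
  refine mul_le_mul_of_nonneg_left ?_ (abs_nonneg _)
  refine (Finset.prod_le_prod (fun σ _ => norm_nonneg _)
    fun σ hσ => hH σ (Finset.ne_of_mem_erase hσ)).trans_eq ?_
  rw [Finset.prod_const, Finset.card_erase_of_mem (Finset.mem_univ _), Finset.card_univ]

/-- Partial sums of a combination of tame power series over the integers of `ℚ(β)`, evaluated at
`β⁻¹`, are zero or bounded below. -/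
theorem exists_partial_sum_lower_bound (hβ : IsIntegral ℤ β) (hβ1 : 1 < β)
    (hconj : ∀ z ∈ (minpoly ℚ β).rootSet ℂ, z ≠ (β : ℂ) → ‖z‖ ≤ 1)
    {ι : Type*} (Λ : Finset ι) (c : ι → ℚ⟮β⟯) (hc : ∀ i ∈ Λ, IsIntegral ℤ (c i))
    {F : ι → PowerSeries ℤ} (hF : ∀ i, Tame (F i)) :
    ∃ (c₁ : ℝ) (Q : ℕ), 0 < c₁ ∧ ∀ n : ℕ,
      ∑ m ∈ Finset.range n,
        (∑ i ∈ Λ, (c i : ℝ) * ((PowerSeries.coeff m (F i) : ℤ) : ℝ)) * β⁻¹ ^ m ≠ 0 →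
      c₁ * β⁻¹ ^ n ≤ |∑ m ∈ Finset.range n,
        (∑ i ∈ Λ, (c i : ℝ) * ((PowerSeries.coeff m (F i) : ℤ) : ℝ)) * β⁻¹ ^ m| *
          ((n : ℝ) + 1) ^ Q := by
  classical
  have hint : IsIntegral ℚ β := hβ.tower_top
  have : FiniteDimensional ℚ ℚ⟮β⟯ := IntermediateField.adjoin.finiteDimensional hint
  have : NumberField ℚ⟮β⟯ := ⟨⟩
  set b : ℚ⟮β⟯ := IntermediateField.AdjoinSimple.gen ℚ β with hb
  have hbβ : (b : ℝ) = β := IntermediateField.AdjoinSimple.coe_gen ℚ β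
  have hbint : IsIntegral ℤ b := by
    rw [← isIntegral_algHom_iff (ℚ⟮β⟯.val.restrictScalars ℤ) Subtype.val_injective]
    exact hβ
  choose M P hM hP using fun i => (hF i).2
  set d := Fintype.card (ℚ⟮β⟯ →ₐ[ℚ] ℂ) - 1 with hd
  set P₀ := ∑ i ∈ Λ, P i with hP₀
  set H : ℝ := ∑ σ : ℚ⟮β⟯ →ₐ[ℚ] ℂ, ∑ i ∈ Λ, ‖σ (c i)‖ * M i + 1 with hH
  have hterm : ∀ σ : ℚ⟮β⟯ →ₐ[ℚ] ℂ, 0 ≤ ∑ i ∈ Λ, ‖σ (c i)‖ * M i := fun σ =>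
    Finset.sum_nonneg fun i _ => mul_nonneg (norm_nonneg _) (hM i)
  have hHσ : ∀ σ : ℚ⟮β⟯ →ₐ[ℚ] ℂ, ∑ i ∈ Λ, ‖σ (c i)‖ * M i ≤ H := fun σ => by
    have := Finset.single_le_sum (fun τ _ => hterm τ) (Finset.mem_univ σ)
    rw [hH]
    linarith
  have hHpos : 0 < H := by
    have := Finset.sum_nonneg fun σ (_ : σ ∈ Finset.univ) => hterm σ
    rw [hH]
    linarith
  refine ⟨(H ^ d)⁻¹, (P₀ + 1) * d, by positivity, fun n hn => ?_⟩
  set s := ∑ m ∈ Finset.range n,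
    (∑ i ∈ Λ, (c i : ℝ) * ((PowerSeries.coeff m (F i) : ℤ) : ℝ)) * β⁻¹ ^ m with hs
  -- Multiplying by `β ^ n` turns powers of `β⁻¹` into nonnegative powers of `β`, which are integral
  -- and have bounded conjugates.
  set y : ℚ⟮β⟯ := ∑ m ∈ Finset.range n,
    (∑ i ∈ Λ, c i * ((PowerSeries.coeff m (F i) : ℤ) : ℚ⟮β⟯)) * b ^ (n - m) with hy
  have hβ0 : β ≠ 0 := by positivity
  have hys : (y : ℝ) = β ^ n * s := by
    rw [hy, hs, Finset.mul_sum]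
    push_cast
    rw [hbβ]
    refine Finset.sum_congr rfl fun m hm => ?_
    have hmn := (Finset.mem_range.1 hm).le
    rw [inv_pow, pow_sub₀ _ hβ0 hmn]
    ring
  have hyint : IsIntegral ℤ y := by
    refine IsIntegral.sum _ fun m _ => IsIntegral.mul (IsIntegral.sum _ fun i hi => ?_)
      (hbint.pow _)
    exact (hc i hi).mul (isIntegral_algebraMap (R := ℤ) (x := PowerSeries.coeff m (F i)))
  have hy0 : y ≠ 0 := by
    intro h0
    rw [h0, ZeroMemClass.coe_zero] at hys
    exact hn ((mul_eq_zero.1 hys.symm).resolve_left (by positivity))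
  have hbound : ∀ σ : ℚ⟮β⟯ →ₐ[ℚ] ℂ, σ ≠ incl β → ‖σ y‖ ≤ H * ((n : ℝ) + 1) ^ (P₀ + 1) := by
    intro σ hσ
    have hσb := norm_embedding_gen_le hβ hconj σ hσ
    have hm : ∀ m ∈ Finset.range n, ‖(∑ i ∈ Λ, σ (c i) *
        ((PowerSeries.coeff m (F i) : ℤ) : ℂ)) * σ b ^ (n - m)‖ ≤ H * ((n : ℝ) + 1) ^ P₀ := by
      intro m hm
      have hmn : (m : ℝ) ≤ n := by exact_mod_cast (Finset.mem_range.1 hm).le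
      rw [norm_mul, norm_pow]
      calc _ ≤ ‖∑ i ∈ Λ, σ (c i) * ((PowerSeries.coeff m (F i) : ℤ) : ℂ)‖ * 1 := by
            gcongr
            exact pow_le_one₀ (norm_nonneg _) hσb
        _ ≤ ∑ i ∈ Λ, ‖σ (c i)‖ * M i * ((n : ℝ) + 1) ^ P₀ := by
            rw [mul_one]
            refine norm_sum_le_of_le _ fun i hi => ?_
            rw [norm_mul, Complex.norm_intCast, abs_of_nonneg (by exact_mod_cast (hF i).1 m),
              mul_assoc]
            gcongr
            refine (hP i m).trans ?_
            have hMi := hM i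
            have hPi : P i ≤ P₀ := Finset.single_le_sum (fun _ _ => Nat.zero_le _) hi
            have h1 : (1 : ℝ) ≤ (n : ℝ) + 1 := by
              have : (0 : ℝ) ≤ n := by positivity
              linarith
            calc _ ≤ M i * ((n : ℝ) + 1) ^ P i := by gcongr
              _ ≤ _ := by gcongr
        _ ≤ H * ((n : ℝ) + 1) ^ P₀ := by
            rw [← Finset.sum_mul]
            gcongr
            exact hHσ σ
    have hσy : σ y = ∑ m ∈ Finset.range n, (∑ i ∈ Λ, σ (c i) *
        ((PowerSeries.coeff m (F i) : ℤ) : ℂ)) * σ b ^ (n - m) := by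
      simp only [hy, map_sum, map_mul, map_pow, map_intCast]
    rw [hσy]
    refine (norm_sum_le_of_le _ hm).trans ?_
    rw [Finset.sum_const, Finset.card_range, nsmul_eq_mul, pow_succ]
    have h2 : 0 ≤ H * ((n : ℝ) + 1) ^ P₀ := by positivity
    nlinarith
  have h := liouville hyint hy0 hbound
  rw [hys, abs_mul, abs_of_pos (by positivity : 0 < β ^ n), mul_pow, ← pow_mul] at h
  rw [inv_pow, ← mul_inv]
  rw [inv_le_iff_one_le_mul₀ (by positivity)]
  refine h.trans_eq ?_
  ring

end Liouville

/-! ### The combined series and its leading monomial -/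

theorem exists_abs_sum_coeff_le {ι : Type*} (Λ : Finset ι) (c : ι → ℝ) {F : ι → PowerSeries ℤ}
    (hF : ∀ i, Tame (F i)) : ∃ (M : ℝ) (P : ℕ), 0 ≤ M ∧ ∀ m : ℕ,
      |∑ i ∈ Λ, c i * ((PowerSeries.coeff m (F i) : ℤ) : ℝ)| ≤ M * ((m : ℝ) + 1) ^ P := by
  choose M P hM hP using fun i => (hF i).2
  refine ⟨∑ i ∈ Λ, |c i| * M i, ∑ i ∈ Λ, P i,
    Finset.sum_nonneg fun i _ => mul_nonneg (abs_nonneg _) (hM i), fun m => ?_⟩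
  rw [Finset.sum_mul]
  refine (Finset.abs_sum_le_sum_abs _ _).trans (Finset.sum_le_sum fun i hi => ?_)
  rw [abs_mul, abs_of_nonneg (a := ((PowerSeries.coeff m (F i) : ℤ) : ℝ))
    (by exact_mod_cast (hF i).1 m), mul_assoc]
  have hMi := hM i
  have h1 : (1 : ℝ) ≤ (m : ℝ) + 1 := by
    have : (0 : ℝ) ≤ m := by positivity
    linarith
  have hPi : P i ≤ ∑ i ∈ Λ, P i := Finset.single_le_sum (fun _ _ => Nat.zero_le _) hi
  gcongr
  calc _ ≤ M i * ((m : ℝ) + 1) ^ P i := hP i m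
    _ ≤ _ := by gcongr

theorem tsum_sum_coeff {ι : Type*} (Λ : Finset ι) (c : ι → ℝ) {F : ι → PowerSeries ℤ}
    (hF : ∀ i, Tame (F i)) {q : ℝ} (h0 : 0 < q) (h1 : q < 1) :
    ∑' m, (∑ i ∈ Λ, c i * ((PowerSeries.coeff m (F i) : ℤ) : ℝ)) * q ^ m =
      ∑ i ∈ Λ, c i * value (F i) q := by
  simp only [Finset.sum_mul, mul_assoc]
  rw [Summable.tsum_finsetSum fun i _ => ((hF i).summable h0 h1).mul_left _]
  exact Finset.sum_congr rfl fun i _ => tsum_mul_left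

theorem supp_monom_nonempty {r : ℕ} {f : Fin r → PowerSeries ℤ} (hf : ∀ i, Tame (f i))
    (hne : ∀ i, (supp (f i)).Nonempty) (k : Fin r → ℕ) : (supp (monom f k)).Nonempty := by
  choose s hs using hne
  rw [supp_monom hf]
  exact ⟨_, fun h => ∑ _j : Fin (k h), s h, fun h => ⟨fun _ => s h, fun _ => hs h, rfl⟩, rfl⟩

theorem add_mem_supp_monom {r : ℕ} {f : Fin r → PowerSeries ℤ} (hf : ∀ i, Tame (f i))
    {k : Fin r → ℕ} {i : Fin r} {a b : ℕ} (ha : a ∈ supp (monom f k)) (hb : b ∈ supp (f i)) :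
    a + b ∈ supp (monom f (k + Pi.single i 1)) := by
  rw [monom_add, monom_single, supp_mul (tame_monom hf k) (hf i)]
  exact ⟨a, ha, b, hb, rfl⟩

/-- A linear relation whose lexicographically leading monomial involves the last two series is
impossible. -/
theorem no_relation {A r : ℕ} (hA : 1 ≤ A) {o d e : Fin r} (ho : o.val = 0) (hd : d.val + 2 = r)
    (he : e.val + 1 = r) {f : Fin r → PowerSeries ℤ}
    (hf : ∀ i, Tame (f i)) (hinf : ∀ i, (supp (f i)).Infinite)
    (h2 : ∀ k : Fin r → ℕ,
      (r = 2 → k o ≤ A - 1) → (3 ≤ r → k o ≤ A) →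
      (fun R : ℝ => R - (theta R (minkowski (gapMult k) fun h => supp (f h)) : ℝ))
        =o[atTop] fun R : ℝ => R / ∏ h, (count (supp (f h)) R : ℝ) ^ k h)
    {δ : ℝ} (hδ : 0 < δ)
    (h3 : (fun R : ℝ => (count (supp (f o)) R : ℝ))
        =o[atTop] fun R : ℝ => R ^ (-δ + 1 / (A : ℝ)))
    (h3' : ∀ i j : Fin r, j.val = i.val + 1 → ∀ ε : ℝ, 0 < ε →
      (fun R : ℝ => (count (supp (f j)) R : ℝ))
        =o[atTop] fun R : ℝ => (count (supp (f i)) R : ℝ) ^ ε)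
    {C₈ C₉ : ℝ} (hC₈ : 0 < C₈) (h4 : ∀ R : ℝ, C₉ ≤ R →
      ∃ n ∈ supp (f e), R ≤ (n : ℝ) ∧ (n : ℝ) ≤ C₈ * R)
    {β : ℝ} (hβ : IsIntegral ℤ β) (hβ1 : 1 < β)
    (hconj : ∀ z ∈ (minpoly ℚ β).rootSet ℂ, z ≠ (β : ℂ) → ‖z‖ ≤ 1)
    (Λ : Finset (Fin r → ℕ)) (c : (Fin r → ℕ) → ℚ⟮β⟯) (hc : ∀ k ∈ Λ, IsIntegral ℤ (c k))
    {g : Fin r → ℕ} (hg : g ∈ Λ) (hcg : 0 < (c g : ℝ))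
    (hlex : ∀ k ∈ Λ, k ≠ g → Pi.Lex (· < ·) (· < ·) k g)
    (hg0 : g o ≤ A) (hg1 : 1 ≤ g d) (hg2 : 1 ≤ g e) :
    ∑ k ∈ Λ, (c k : ℝ) * value (monom f k) β⁻¹ ≠ 0 := by
  classical
  intro hrel
  have hq0 : 0 < β⁻¹ := by positivity
  have hq1 : β⁻¹ < 1 := inv_lt_one_of_one_lt₀ hβ1
  have heq : ∀ h : Fin r, h.val + 1 = r → h = e := fun h hh => Fin.ext (by omega)
  set a : Fin r → ℕ → ℕ := fun h N => count (supp (f h)) N with ha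
  have hcast : Tendsto (fun N : ℕ => (N : ℝ)) atTop atTop := tendsto_natCast_atTop_atTop
  have hpos : ∀ i, ∀ᶠ N in atTop, 1 ≤ a i N := by
    intro i
    obtain ⟨n, hn⟩ := (hinf i).nonempty
    filter_upwards [eventually_gt_atTop n] with N hN
    exact (Set.ncard_pos (finite_lt _ _)).2 ⟨n, hn, Nat.cast_lt.2 hN⟩
  have hpow : ∀ i j : Fin r, i < j → ∀ M : ℕ, ∀ᶠ N in atTop, a j N ^ M ≤ a i N :=
    fun i j hij M => eventually_pow_le hpos
      (fun i j hij ε hε => (h3' i j hij ε hε).comp_tendsto hcast) hij M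
  obtain ⟨η, hη, hη1, hgrow⟩ := exists_eventually_prod_le_rpow hpos hpow hA o ho hδ
    (h3.comp_tendsto hcast)
  obtain ⟨D, hD⟩ : ∃ D, ∀ k ∈ Λ, ∀ h, k h ≤ D :=
    ⟨Λ.sup fun k => Finset.univ.sup k, fun k hk h =>
      (Finset.le_sup (f := k) (Finset.mem_univ h)).trans
        (Finset.le_sup (f := fun k : Fin r → ℕ => Finset.univ.sup k) hk)⟩
  -- All exponents of the box below `g` are included, not only those of the relation, so that
  -- multiplying by the last series stays in the family until `g` is reached.
  set 𝓚 := (Fintype.piFinset fun _ : Fin r => Finset.range (D + 1)).filter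
    (fun k => Pi.Lex (· < ·) (· < ·) k g) with h𝓚
  have hmem𝓚 : ∀ k, k ∈ 𝓚 ↔ (∀ h, k h ≤ D) ∧ Pi.Lex (· < ·) (· < ·) k g := by
    intro k
    simp [h𝓚]
  -- Exponents from which multiplication by the last series alone never leads to `g`.
  set 𝓔 := 𝓚.filter (fun k => ∃ h, h < e ∧ k h ≠ g h) with h𝓔
  set B : Set ℕ := ⋃ k ∈ 𝓚, supp (monom f k) with hB
  set E : Set ℕ := ⋃ k ∈ 𝓔, supp (monom f k) with hE
  set T : Set ℕ := supp (monom f g) with hT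
  have hmemB : ∀ k ∈ 𝓚, ∀ m ∈ supp (monom f k), m ∈ B := fun k hk m hm =>
    Set.mem_biUnion hk hm
  -- Entry `d` is lowered by one because `gapMult` restores it. The last entry can be as large as
  -- `D`, since `gapMult` discards it; this lets `K` dominate every exponent first falling below `g`
  -- at `d`.
  set K : Fin r → ℕ := fun h => if h.val + 2 < r then g h else if h.val + 2 = r then g h - 1 else D
    with hK
  have hKo : K o ≤ A := by
    simp only [hK]
    split_ifs with h5 h6
    · exact hg0
    · omega
    · omega
  set G : ℕ → ℝ := fun m =>
    ∑ k ∈ Λ, (c k : ℝ) * ((PowerSeries.coeff m (monom f k) : ℤ) : ℝ) with hG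
  obtain ⟨M, P, hM, hGle⟩ := exists_abs_sum_coeff_le Λ (fun k => (c k : ℝ)) (tame_monom hf)
  obtain ⟨c₁, Q, hc₁, harith⟩ :=
    exists_partial_sum_lower_bound hβ hβ1 hconj Λ c hc (tame_monom hf)
  have hΛ𝓚 : ∀ k ∈ Λ, k ≠ g → k ∈ 𝓚 := fun k hk hne => (hmem𝓚 k).2 ⟨hD k hk, hlex k hk hne⟩
  have hGT : ∀ m, m ∉ B → G m = c g * ((PowerSeries.coeff m (monom f g) : ℤ) : ℝ) := by
    intro m hm
    refine Finset.sum_eq_single_of_mem g hg fun k hk hne => ?_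
    have : PowerSeries.coeff m (monom f k) = 0 := by
      by_contra h
      exact hm (hmemB k (hΛ𝓚 k hk hne) m h)
    rw [this, Int.cast_zero, mul_zero]
  have hlex0 : ∀ k, Pi.Lex (· < ·) (· < ·) k g → k o ≤ g o := by
    rintro k ⟨i, hi, hlt⟩
    rcases Nat.eq_zero_or_pos i.val with h0 | h0
    · rw [show o = i from Fin.ext (by omega)]; exact hlt.le
    · exact (hi o (Fin.lt_def.2 (by omega))).le
  set C : ℝ := (insert g 𝓚).card + 1 with hC
  have hC0 : 0 < C := by positivity
  have hCE : (𝓔.card : ℝ) ≤ C := by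
    have : 𝓔.card ≤ (insert g 𝓚).card :=
      Finset.card_le_card ((Finset.filter_subset _ _).trans (Finset.subset_insert _ _))
    have h' : (𝓔.card : ℝ) ≤ (insert g 𝓚).card := by exact_mod_cast this
    linarith
  refine sparse_series_contradiction hq0 hq1 (G := G) (B := B) (T := T) (E := E)
    (S := supp (f e)) (w := fun N => ∏ h, a h N ^ K h) (C := C) (C₈ := C₈) (C₉ := C₉) (M := M)
    (c₀ := c g) (c₁ := c₁) (P := P) (Q := Q) hη hη1 hC0 hC₈ ?_ ?_ ?_ ?_ ?_ ?_ ?_ ?_ h4 hM hGle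
    ?_ ?_ ?_ hcg ?_ hc₁ harith
  · refine hmemB 0 ((hmem𝓚 0).2 ⟨fun _ => Nat.zero_le _, ?_⟩) 0 ?_
    · exact Pi.lex_lt_of_lt wellFounded_lt
        (lt_of_le_of_ne (fun _ => Nat.zero_le _) fun h0 => by rw [← h0] at hg2; simp at hg2)
    · simp [monom, supp]
  · have hev : ∀ᶠ N : ℕ in atTop, ∀ k ∈ insert g 𝓚,
        ((∏ j, a j N ^ k j : ℕ) : ℝ) ≤ (N : ℝ) ^ (1 - η) := by
      refine (Finset.eventually_all _).2 fun k hk => hgrow k ?_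
      rcases Finset.mem_insert.1 hk with rfl | hk
      · exact hg0
      · exact (hlex0 k ((hmem𝓚 k).1 hk).2).trans hg0
    filter_upwards [hev] with N hN
    have h5 : count (B ∪ T) N ≤ ∑ k ∈ insert g 𝓚, ∏ j, a j N ^ k j := by
      rw [Set.union_comm, hB, hT,
        ← Finset.set_biUnion_insert g 𝓚 fun k => supp (monom f k)]
      exact (count_biUnion_le _ _ _).trans
        (Finset.sum_le_sum fun k _ => count_supp_monom_le hf k _)
    calc ((count (B ∪ T) N : ℕ) : ℝ) ≤ ∑ k ∈ insert g 𝓚, ((∏ j, a j N ^ k j : ℕ) : ℝ) := by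
          exact_mod_cast h5
      _ ≤ (insert g 𝓚).card • (N : ℝ) ^ (1 - η) := Finset.sum_le_card_nsmul _ _ _ hN
      _ ≤ C * (N : ℝ) ^ (1 - η) := by
        rw [nsmul_eq_mul]
        gcongr
        linarith
  -- An exponent of `𝓔` first drops below `g` at some `i < e`. For `i < d` the growth comparison
  -- applies; for `i = d` it is at most `K` entry by entry.
  · have hev : ∀ᶠ N : ℕ in atTop, ∀ k ∈ 𝓔, ∏ j, a j N ^ k j ≤ ∏ j, a j N ^ K j := by
      refine (Finset.eventually_all _).2 fun k hk => ?_
      obtain ⟨hk𝓚, h, hhe, hne⟩ := Finset.mem_filter.1 hk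
      obtain ⟨hkD, i, hi, hlt⟩ := (hmem𝓚 k).1 hk𝓚
      have hie : i.val + 1 < r := by
        have h6 : i ≤ h := not_lt.1 fun h6 => hne (hi h h6)
        have h7 := Fin.lt_def.1 (lt_of_le_of_lt h6 hhe)
        omega
      have hKj : ∀ j, j < i → k j ≤ K j := by
        intro j hj
        have := Fin.lt_def.1 hj
        simp only [hK]
        rw [if_pos (by omega)]
        exact (hi j hj).le
      rcases (by omega : i.val + 2 < r ∨ i.val + 2 = r) with hir | hir
      · refine eventually_prod_le_of_lex hpos hpow i hKj ?_
        simp only [hK]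
        rwa [if_pos hir]
      · filter_upwards [eventually_all.2 hpos] with N hN
        refine Finset.prod_le_prod' fun j _ => Nat.pow_le_pow_right (hN j) ?_
        rcases lt_trichotomy j i with hj | rfl | hj
        · exact hKj j hj
        · simp only [hK]
          rw [if_neg (by omega), if_pos hir]
          have : k j < g j := hlt
          omega
        · have := Fin.lt_def.1 hj
          simp only [hK]
          rw [if_neg (by omega), if_neg (by omega)]
          exact hkD j
    filter_upwards [hev] with N hN
    have h5 : count E N ≤ 𝓔.card • ∏ j, a j N ^ K j :=
      (count_biUnion_le _ _ _).trans ((Finset.sum_le_sum fun k hk =>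
        (count_supp_monom_le hf k _).trans (hN k hk)).trans_eq (Finset.sum_const _))
    calc ((count E N : ℕ) : ℝ) ≤ 𝓔.card * ((∏ j, a j N ^ K j : ℕ) : ℝ) := by exact_mod_cast h5
      _ ≤ _ := by gcongr
  · filter_upwards [hgrow K hKo] with N hN
    refine hN.trans (le_mul_of_one_le_left (by positivity) ?_)
    rw [hC]
    have : (0 : ℝ) ≤ (insert g 𝓚).card := by positivity
    linarith
  · intro N N' hNN
    exact Finset.prod_le_prod' fun j _ => Nat.pow_le_pow_left
      (count_mono _ (by exact_mod_cast hNN)) _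
  · filter_upwards [eventually_all.2 hpos] with N hN
    exact Nat.succ_le_of_lt (Finset.prod_pos fun j _ => Nat.pow_pos (hN j))
  · intro ε hε
    have hgapK : gapMult K = Function.update g e 0 := by
      funext h
      simp only [gapMult, hK]
      by_cases h5 : h.val + 2 < r
      · rw [if_pos h5, if_pos h5, Function.update_of_ne]
        rintro rfl
        omega
      · by_cases h6 : h.val + 2 = r
        · rw [if_neg h5, if_pos h6, if_neg h5, if_pos h6, Function.update_of_ne]
          · rw [show h = d from Fin.ext (by omega)]
            omega
          · rintro rfl
            omega
        · have hlt := h.isLt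
          rw [if_neg h5, if_neg h6, heq h (by omega), Function.update_self]
    have hmem : Function.update g e 0 ∈ 𝓚 := by
      refine (hmem𝓚 _).2 ⟨fun h => ?_, e, fun j hj => Function.update_of_ne hj.ne _ _, ?_⟩
      · rcases eq_or_ne h e with rfl | hne
        · rw [Function.update_self]; exact Nat.zero_le _
        · rw [Function.update_of_ne hne]; exact hD g hg h
      · rw [Function.update_self]; exact hg2
    -- For `r = 2` the indices `o` and `d` coincide, and the lowered entry meets the stricter bound
    -- `A - 1`.
    have h5 := h2 K (fun hr2 => by
      simp only [hK]
      rw [if_neg (by omega), if_pos (by omega)]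
      exact Nat.sub_le_sub_right hg0 1) (fun _ => hKo)
    rw [hgapK, ← supp_monom hf] at h5
    obtain ⟨b, hb⟩ := supp_monom_nonempty hf (fun i => (hinf i).nonempty) (Function.update g e 0)
    filter_upwards [(h5.comp_tendsto hcast).bound hε, eventually_gt_atTop b] with n hn hbn
    obtain ⟨hθ, hθn⟩ := (isGreatest_theta (R := (n : ℝ)) ⟨b, hb, Nat.cast_lt.2 hbn⟩).1
    refine ⟨_, hmemB _ hmem _ hθ, Nat.cast_lt.1 hθn, ?_⟩
    refine (le_abs_self _).trans (hn.trans_eq ?_)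
    simp only [Function.comp]
    rw [Real.norm_of_nonneg (by positivity)]
    push_cast
    rfl
  · intro i hiB hiE s hs
    obtain ⟨k, hk, hik⟩ := Set.mem_iUnion₂.1 hiB
    have hkg : ∀ h, h < e → k h = g h := by
      intro h hh
      by_contra hne
      exact hiE (Set.mem_biUnion (Finset.mem_filter.2 ⟨hk, h, hh, hne⟩) hik)
    obtain ⟨hkD, j, hj, hlt⟩ := (hmem𝓚 k).1 hk
    have hlt' : k j < g j := hlt
    have hje : j = e := by
      by_contra hne
      have h6 : j < e := by
        rw [Fin.lt_def]
        have h7 := j.isLt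
        have h8 : j.val ≠ e.val := fun h => hne (Fin.ext h)
        omega
      exact absurd (hkg j h6) hlt'.ne
    rw [hje] at hlt'
    have hadd := add_mem_supp_monom hf hik hs
    have hof : ∀ h, h ≠ e → (k + Pi.single e 1 : Fin r → ℕ) h = g h := by
      intro h hne
      rw [Pi.add_apply, Pi.single_eq_of_ne hne, add_zero]
      refine hkg h ?_
      rw [Fin.lt_def]
      have h7 := h.isLt
      have h8 : h.val ≠ e.val := fun h' => hne (Fin.ext h')
      omega
    have hself : (k + Pi.single e 1 : Fin r → ℕ) e = k e + 1 := by
      rw [Pi.add_apply, Pi.single_eq_same]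
    -- One more factor of the last series either produces `g` itself or stays lexicographically
    -- below it.
    rcases (by omega : k e + 1 = g e ∨ k e + 1 < g e) with h6 | h6
    · right
      have : (k + Pi.single e 1 : Fin r → ℕ) = g := by
        funext h
        rcases eq_or_ne h e with rfl | hne
        · rw [hself, h6]
        · exact hof h hne
      rwa [this] at hadd
    · left
      refine hmemB _ ((hmem𝓚 _).2 ⟨fun h => ?_, e, fun h hh => hof h hh.ne, ?_⟩) _ hadd
      · rcases eq_or_ne h e with hh | hne
        · rw [hh, hself]; have := hD g hg e; omega
        · rw [hof h hne]; exact hD g hg h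
      · rw [hself]; exact h6
  · rw [← hrel]
    exact tsum_sum_coeff Λ (fun k => (c k : ℝ)) (tame_monom hf) hq0 hq1
  · intro m hm
    rw [hGT m fun h => hm (Or.inl h)]
    have : PowerSeries.coeff m (monom f g) = 0 := by
      by_contra h
      exact hm (Or.inr h)
    rw [this, Int.cast_zero, mul_zero]
  · intro m hm
    rw [hGT m hm]
    exact mul_nonneg hcg.le (by exact_mod_cast (tame_monom hf g).1 m)
  · intro m hmT hmB
    rw [hGT m hmB]
    refine le_mul_of_one_le_right hcg.le ?_
    have h5 : 1 ≤ PowerSeries.coeff m (monom f g) :=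
      lt_of_le_of_ne ((tame_monom hf g).1 m) (Ne.symm hmT)
    exact_mod_cast h5

end PisotSalem

/-! ### Normalization of a linear relation -/

theorem mainTheorem5 (A r : ℕ) (hA : 1 ≤ A) (hr : 2 ≤ r) (f : Fin r → PowerSeries ℤ)
    (hf : ∀ i, PisotSalem.IsNonpolynomial (f i))
    -- the coefficients are nonnegative and bounded
    (h1 : ∃ C₇ : ℝ, 0 < C₇ ∧ ∀ (i : Fin r) (n : ℕ),
      0 ≤ PowerSeries.coeff n (f i) ∧ ((PowerSeries.coeff n (f i) : ℤ) : ℝ) ≤ C₇)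
    -- gap estimates for the Minkowski sums of the supports
    (h2 : ∀ k : Fin r → ℕ,
      (r = 2 → k ⟨0, by omega⟩ ≤ A - 1) → (3 ≤ r → k ⟨0, by omega⟩ ≤ A) →
      (fun R : ℝ => R - (PisotSalem.theta R
          (PisotSalem.minkowski (PisotSalem.gapMult k) fun h => PisotSalem.supp (f h)) : ℝ))
        =o[atTop] fun R : ℝ =>
          R / ∏ h, (PisotSalem.count (PisotSalem.supp (f h)) R : ℝ) ^ k h)
    -- growth of the counting functions
    (h3 : ∃ δ : ℝ, 0 < δ ∧
      (fun R : ℝ => (PisotSalem.count (PisotSalem.supp (f ⟨0, by omega⟩)) R : ℝ))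
        =o[atTop] fun R : ℝ => R ^ (-δ + 1 / (A : ℝ)))
    (h3' : ∀ i j : Fin r, j.val = i.val + 1 → ∀ ε : ℝ, 0 < ε →
      (fun R : ℝ => (PisotSalem.count (PisotSalem.supp (f j)) R : ℝ))
        =o[atTop] fun R : ℝ => (PisotSalem.count (PisotSalem.supp (f i)) R : ℝ) ^ ε)
    -- the support of the last series meets every interval `[R, C₈ R]` with `R` large
    (h4 : ∃ C₈ C₉ : ℝ, 0 < C₈ ∧ 0 < C₉ ∧ ∀ R : ℝ, C₉ ≤ R →
      ∃ n ∈ PisotSalem.supp (f ⟨r - 1, by omega⟩), R ≤ (n : ℝ) ∧ (n : ℝ) ≤ C₈ * R)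
    (β : ℝ) (hβ : PisotSalem.IsPisot β ∨ PisotSalem.IsSalem β) :
    LinearIndependent ℚ⟮β⟯
      (fun k : {k : Fin r → ℕ // k ⟨0, by omega⟩ ≤ A} =>
        ∏ i, PisotSalem.value (f i) β⁻¹ ^ k.val i) := by
  classical
  obtain ⟨hint, hβ1, hconj⟩ := PisotSalem.conj_norm_le_of_isPisot_or_isSalem hβ
  obtain ⟨C₇, hC₇, h1⟩ := h1
  obtain ⟨δ, hδ, h3⟩ := h3
  obtain ⟨C₈, C₉, hC₈, -, h4⟩ := h4
  have htame : ∀ i, PisotSalem.Tame (f i) := fun i =>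
    ⟨fun n => (h1 i n).1, C₇, 0, hC₇.le, fun n => by simpa using (h1 i n).2⟩
  have hinf := fun i => PisotSalem.supp_infinite (hf i)
  have hq0 : 0 < β⁻¹ := by positivity
  have hq1 : β⁻¹ < 1 := inv_lt_one_of_one_lt₀ hβ1
  have : FiniteDimensional ℚ ℚ⟮β⟯ := IntermediateField.adjoin.finiteDimensional hint.tower_top
  rw [linearIndependent_iff']
  intro s b hsum
  by_contra! hcon
  obtain ⟨k₀, hk₀, hbk₀⟩ := hcon
  set b' : (Fin r → ℕ) → ℚ⟮β⟯ := fun k => if h : k ⟨0, by omega⟩ ≤ A then b ⟨k, h⟩ else 0 with hb'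
  have hb'b : ∀ k, b' k.val = b k := fun k => by simp only [hb']; rw [dif_pos k.2]
  set Λ : Finset (Fin r → ℕ) := (s.filter (b · ≠ 0)).map ⟨Subtype.val, Subtype.val_injective⟩
    with hΛ
  have hΛmem : ∀ k ∈ Λ, k ⟨0, by omega⟩ ≤ A ∧ b' k ≠ 0 := by
    intro k hk
    obtain ⟨k, hk', rfl⟩ := Finset.mem_map.1 hk
    exact ⟨k.2, by rw [Function.Embedding.coeFn_mk, hb'b]; exact (Finset.mem_filter.1 hk').2⟩
  have hrel : ∑ k ∈ Λ, (b' k : ℝ) * PisotSalem.value (PisotSalem.monom f k) β⁻¹ = 0 := by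
    rw [hΛ, Finset.sum_map, Finset.sum_filter_of_ne]
    · rw [← hsum]
      refine Finset.sum_congr rfl fun k _ => ?_
      rw [Function.Embedding.coeFn_mk, hb'b, PisotSalem.value_monom htame hq0 hq1]
      rfl
    · intro k _ hne h0
      rw [Function.Embedding.coeFn_mk, hb'b, h0] at hne
      simp at hne
  obtain ⟨g, hg, hmax⟩ := Finset.exists_max_image Λ toLex
    ⟨k₀.val, Finset.mem_map.2 ⟨k₀, Finset.mem_filter.2 ⟨hk₀, hbk₀⟩, rfl⟩⟩
  have hlex : ∀ k ∈ Λ, k ≠ g → Pi.Lex (· < ·) (· < ·) k g := fun k hk hne =>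
    lt_of_le_of_ne (hmax k hk) fun h => hne (toLex.injective h)
  -- A common denominator, with its sign chosen to make the leading coefficient positive.
  obtain ⟨y, hy0, hyint⟩ : ∃ y : ℤ, 0 < y * (b' g : ℝ) ∧ ∀ k ∈ Λ, IsIntegral ℤ (y * b' k) := by
    obtain ⟨y, hy0, hy⟩ := exists_integral_multiples ℤ ℚ (Λ.image b')
    have hy' : ∀ k ∈ Λ, IsIntegral ℤ (y * b' k) := fun k hk => by
      simpa [zsmul_eq_mul] using hy _ (Finset.mem_image_of_mem _ hk)
    have hne : (y : ℝ) * (b' g : ℝ) ≠ 0 :=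
      mul_ne_zero (by exact_mod_cast hy0) (by exact_mod_cast (hΛmem g hg).2)
    rcases hne.lt_or_gt with h | h
    · refine ⟨-y, by push_cast; linarith, fun k hk => ?_⟩
      push_cast
      rw [neg_mul]
      exact (hy' k hk).neg
    · exact ⟨y, h, hy'⟩
  set e : Fin r := ⟨r - 1, by omega⟩ with he
  set d : Fin r := ⟨r - 2, by omega⟩ with hd
  have hde : d ≠ e := fun h => by
    have := congrArg Fin.val h
    simp only [hd, he] at this
    omega
  -- The shift makes the last two entries of the leading exponent positive. Entry `d` is raised only
  -- from 0 to 1, so for `r = 2`, where it is the first entry, the bound by `A ≥ 1` survives.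
  set v : Fin r → ℕ := Pi.single e 1 + if g d = 0 then Pi.single d 1 else 0 with hv
  -- The truncated subtraction is harmless: `c` is used only at exponents of the form `k + v`.
  set c : (Fin r → ℕ) → ℚ⟮β⟯ := fun k => y * b' (k - v) with hc
  have hcadd : ∀ k, c (k + v) = y * b' k := fun k => by simp only [hc, add_tsub_cancel_right]
  refine PisotSalem.no_relation hA (o := ⟨0, by omega⟩) (d := d) (e := e) rfl
    (Nat.sub_add_cancel hr) (Nat.sub_add_cancel (by omega)) htame hinf h2 hδ h3 h3' hC₈ h4 hint hβ1 hconj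
    (Λ.map (addRightEmbedding v)) c ?_ (g := g + v) ?_ ?_ ?_ ?_ ?_ ?_ ?_
  · intro k hk
    obtain ⟨k, hk', rfl⟩ := Finset.mem_map.1 hk
    rw [addRightEmbedding_apply, hcadd]
    exact hyint k hk'
  · exact Finset.mem_map.2 ⟨g, hg, rfl⟩
  · rw [hcadd]
    push_cast
    exact hy0
  · intro k hk hne
    obtain ⟨k, hk', rfl⟩ := Finset.mem_map.1 hk
    rw [addRightEmbedding_apply] at hne ⊢
    obtain ⟨i, hi, hlt⟩ := hlex k hk' fun h => hne (by rw [h])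
    exact ⟨i, fun j hj => by rw [Pi.add_apply, Pi.add_apply, hi j hj],
      Nat.add_lt_add_right hlt _⟩
  · have h0e : (⟨0, by omega⟩ : Fin r) ≠ e := fun h => by
      have := congrArg Fin.val h
      simp only [he] at this
      omega
    rw [Pi.add_apply, hv, Pi.add_apply, Pi.single_eq_of_ne h0e, zero_add]
    have hgA := (hΛmem g hg).1
    split_ifs with h
    · rcases eq_or_ne (⟨0, by omega⟩ : Fin r) d with h0 | h0
      · rw [h0, h, Pi.single_eq_same]
        exact hA
      · rw [Pi.single_eq_of_ne h0]
        exact hgA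
    · exact hgA
  · rw [Pi.add_apply, hv, Pi.add_apply, Pi.single_eq_of_ne hde]
    split_ifs with h
    · rw [Pi.single_eq_same]; omega
    · omega
  · rw [Pi.add_apply, hv, Pi.add_apply, Pi.single_eq_same]
    omega
  -- The shifted relation is the old one times a common factor, whose nonvanishing is not needed.
  · rw [Finset.sum_map]
    have hterm : ∀ k ∈ Λ, ((c (addRightEmbedding v k) : ℚ⟮β⟯) : ℝ) *
        PisotSalem.value (PisotSalem.monom f (addRightEmbedding v k)) β⁻¹ =
        (b' k : ℝ) * PisotSalem.value (PisotSalem.monom f k) β⁻¹ *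
          (y * PisotSalem.value (PisotSalem.monom f v) β⁻¹) := by
      intro k _
      rw [addRightEmbedding_apply, hcadd, PisotSalem.monom_add, PisotSalem.value_mul
        (PisotSalem.tame_monom htame k) (PisotSalem.tame_monom htame v) hq0 hq1]
      push_cast
      ring
    rw [Finset.sum_congr rfl hterm, ← Finset.sum_mul, hrel, zero_mul]
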